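/- Let $f:\mathbb{R}\to\mathbb{R}$ be convex with $\lim_{|p|\to\infty} f(p)/|p| = \infty$, and let $f^*(q)=\sup_{p\in\mathbb{R}}(pq-f(p))$ be its Fenchel dual. For $u_0\in L^\infty(\mathbb{R})$ put $v_0(x)=\int_0^x u_0(y)\,dy$ and, for $t>0$, \[ V(x,t)=\inf_{y\in\mathbb{R}}\Big\{v_0(y)+t f^*\Big(\frac{x-y}{t}\Big)\Big\},\qquad u:=\frac{\partial V}{\partial x}. \] Then $u$ (the Lax–Oleinik solution with initial datum $u_0$) is defined almost everywhere in $\mathbb{R}\times(0,\infty)$, is essentially bounded, and is a weak solution of $u_t+f(u)_x=0$, $u(\cdot,0)=u_0$: \[ \int_0^\infty\!\!\int_{\mathbb{R}}\big(u\varphi_t+f(u)\varphi_x\big)\,dx\,dt+\int_{\mathbb{R}}u_0(x)\varphi(x,0)\,dx=0\qquad\text{for all }\varphi\in C_c^\infty(\mathbb{R}\times[0,\infty)). \] Moreover: 1. (Comparison principle.) Let $u_{10},u_{20}\in L^\infty(\mathbb{R})$ and let $u_1,u_2$ be the corresponding Lax–Oleinik solutions. If $u_{10}\le u_{20}$ a.e.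 in $\mathbb{R}$, then $u_1\le u_2$ a.e. in $\mathbb{R}\times(0,\infty)$. 2. Let $u_{10},u_{20}\in L^1(\mathbb{R})$, and for $i=1,2$ let $u_{i0n}\in L^\infty(\mathbb{R})\cap L^1(\mathbb{R})$ converge to $u_{i0}$ in $L^1(\mathbb{R})$ as $n\to\infty$. Let $u_{in}$ be the Lax–Oleinik solution with initial datum $u_{i0n}$. Then: (a) for every $T>0$, $(u_{1n})_n$ and $(u_{2n})_n$ are Cauchy sequences in $L^1(\mathbb{R}\times(0,T))$; hence, for $i=1,2$, there is a function $u_i$ on $\mathbb{R}\times(0,\infty)$, the same for all $T$, such that $u_{in}\to u_i$ in $L^1(\mathbb{R}\times(0,T))$ for every $T>0$; (b) for $0<\tau<T$, the limits $u_1,u_2$ in $L^1(\mathbb{R}\times(0,T))$ satisfy \[ \int_{\mathbb{R}}\int_\tau^T|u_1(x,t)-u_2(x,t)|\,dt\,dx\le (T-\tau)\int_{\mathbb{R}}|u_{10}(x)-u_{20}(x)|\,dx; \] (c) the limit does not depend on the approximation: if $v_{i0n}\in L^\infty(\mathbb{R})\cap L^1(\mathbb{R})$ also converges to $u_{i0}$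 in $L^1(\mathbb{R})$, and $v_i$ is the limit, in $L^1(\mathbb{R}\times(0,T))$ for all $T>0$, of the Lax–Oleinik solutions with initial data $v_{i0n}$, then $u_i=v_i$ a.e. in $\mathbb{R}\times(0,\infty)$. 3. Let $u_0\in L^1(\mathbb{R})$ and let $u$ be the limit obtained from $u_0$ as in 2. Then: (a) $u\in L^\infty(K)$ for every compact $K\subset\mathbb{R}\times(0,\infty)$; (b) $u$ and $f(u)$ are in $L^1_{\mathrm{loc}}(\mathbb{R}\times(0,\infty))$ and $\int_0^\infty\int_{\mathbb{R}}\big(u\varphi_t+f(u)\varphi_x\big)\,dx\,dt=0$ for all $\varphi\in C_c^\infty(\mathbb{R}\times(0,\infty))$; (c) there is a Lebesgue null set $N\subset(0,\infty)$ such that $u(\cdot,t)\in L^1(\mathbb{R})$ for every $t\in(0,\infty)\setminus N$ and, for all $a\le b$, \[ \lim_{t\to0^+,\ t\notin N}\int_a^b u(x,t)\,dx=\int_a^b u_0(x)\,dx. \] -/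

import Mathlib

open MeasureTheory Set Filter Topology
open scoped ContDiff

noncomputable section

namespace ScalarConservation

/-- Superlinear growth: `f p / |p| → +∞` as `|p| → ∞`. -/
def Superlinear (f : ℝ → ℝ) : Prop :=
  Tendsto (fun p : ℝ => f p / |p|) (cocompact ℝ) atTop

/-- The primitive `v₀(x) = ∫₀ˣ u₀` of the initial datum. -/
def primitive (u₀ : ℝ → ℝ) (x : ℝ) : ℝ :=
  ∫ y in (0 : ℝ)..x, u₀ y

/-- The Fenchel dual `f*(q) = sup_p (p q - f p)`; the supremum is finite when `f` is convex
and superlinear. -/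
def fenchelDual (f : ℝ → ℝ) (q : ℝ) : ℝ :=
  ⨆ p : ℝ, (p * q - f p)

/-- The value function `V(x,t) = inf_y (v₀(y) + t f*((x - y)/t))`, for `t > 0`; the infimum is
finite when `f` is convex and superlinear and `u₀` is bounded. -/
def valueFunction (f u₀ : ℝ → ℝ) (x t : ℝ) : ℝ :=
  ⨅ y : ℝ, (primitive u₀ y + t * fenchelDual f ((x - y) / t))

/-- The Lax-Oleinik solution `u = ∂V/∂x`, as a function of the point `p = (x, t)`. -/
def laxOleinik (f u₀ : ℝ → ℝ) (p : ℝ × ℝ) : ℝ :=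
  deriv (fun x : ℝ => valueFunction f u₀ x p.2) p.1

/-- Lebesgue measure on `ℝ × (0, ∞)`. -/
def halfPlaneMeasure : Measure (ℝ × ℝ) :=
  volume.restrict (univ ×ˢ Ioi (0 : ℝ))

/-- Lebesgue measure on `ℝ × (τ, T)`. -/
def stripMeasure (τ T : ℝ) : Measure (ℝ × ℝ) :=
  volume.restrict (univ ×ˢ Ioo τ T)

/-- The partial derivative `∂φ/∂x` of a function of `(x, t)`. -/
def partialX (φ : ℝ × ℝ → ℝ) (p : ℝ × ℝ) : ℝ :=
  fderiv ℝ φ p (1, 0)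

/-- The partial derivative `∂φ/∂t` of a function of `(x, t)`. -/
def partialT (φ : ℝ × ℝ → ℝ) (p : ℝ × ℝ) : ℝ :=
  fderiv ℝ φ p (0, 1)

/-- `u` is an essentially bounded weak solution of `u_t + f(u)_x = 0`, `u(·,0) = u₀`, on
`ℝ × (0, ∞)`. The test functions in `C_c^∞(ℝ × [0, ∞))` are the restrictions of functions in
`C_c^∞(ℝ²)`. -/
structure IsBoundedWeakSolution (f u₀ : ℝ → ℝ) (u : ℝ × ℝ → ℝ) : Prop where
  memLp_top : MemLp u ⊤ halfPlaneMeasure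
  weak : ∀ φ : ℝ × ℝ → ℝ, ContDiff ℝ ∞ φ → HasCompactSupport φ →
    (∫ p, (u p * partialT φ p + f (u p) * partialX φ p) ∂halfPlaneMeasure)
      + ∫ x : ℝ, u₀ x * φ (x, 0) = 0

/-- `u` and `f(u)` are in `L¹_loc(ℝ × (0, ∞))` and `u_t + f(u)_x = 0` holds in the sense of
distributions on `ℝ × (0, ∞)`. -/
structure IsDistributionalSolution (f : ℝ → ℝ) (u : ℝ × ℝ → ℝ) : Prop where
  locallyIntegrable : LocallyIntegrableOn u (univ ×ˢ Ioi (0 : ℝ))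
  locallyIntegrable_flux : LocallyIntegrableOn (fun p => f (u p)) (univ ×ˢ Ioi (0 : ℝ))
  weak : ∀ φ : ℝ × ℝ → ℝ, ContDiff ℝ ∞ φ → HasCompactSupport φ →
    tsupport φ ⊆ univ ×ˢ Ioi (0 : ℝ) →
    ∫ p, (u p * partialT φ p + f (u p) * partialX φ p) ∂halfPlaneMeasure = 0

/-- A sequence `w n` in `L^∞(ℝ) ∩ L¹(ℝ)` that converges to `u₀ ∈ L¹(ℝ)` in `L¹(ℝ)`. -/
structure IsApproximation (w : ℕ → ℝ → ℝ) (u₀ : ℝ → ℝ) : Prop where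
  memLp_one_limit : MemLp u₀ 1 volume
  memLp_one : ∀ n, MemLp (w n) 1 volume
  memLp_top : ∀ n, MemLp (w n) ⊤ volume
  tendsto : Tendsto (fun n => eLpNorm (w n - u₀) 1 volume) atTop (𝓝 0)

/-- `u n` is a Cauchy sequence in `L¹(μ)`. -/
structure IsCauchyL1 (μ : Measure (ℝ × ℝ)) (u : ℕ → ℝ × ℝ → ℝ) : Prop where
  memLp_one : ∀ n, MemLp (u n) 1 μ
  cauchy : ∀ ε : ENNReal, 0 < ε → ∃ M : ℕ, ∀ m ≥ M, ∀ n ≥ M, eLpNorm (u m - u n) 1 μ < ε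

/-- `v` is (a version of) the limit of the sequence `u n` in `L¹(μ)`. -/
structure IsLimitL1 (μ : Measure (ℝ × ℝ)) (u : ℕ → ℝ × ℝ → ℝ) (v : ℝ × ℝ → ℝ) : Prop where
  memLp_one : MemLp v 1 μ
  tendsto : Tendsto (fun n => eLpNorm (u n - v) 1 μ) atTop (𝓝 0)

end ScalarConservation

end

open ScalarConservation

/-!
For `t > 0` the Hopf–Lax function `V` satisfies two one-sided dynamic programming inequalities:
along any line of slope `q` it grows at most at the rate `f*(q)` (`hopfLax_add_le`, by convexity of
`f*`), and through each point passes a line, issuing from a minimizer, along which it grows at least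
at that rate (`exists_hopfLax_sub_add_le`). With Young's inequality and `f ≤ f**` these give
`V_t + f(V_x) = 0` wherever `V` is differentiable (`hamiltonJacobi`), and they turn a Lipschitz bound
in `x` into one in `(x, t)` (`exists_lipschitzWith_hopfLax_max`). By Rademacher's theorem the equation
holds almost everywhere, and the conservation law for `u = V_x` is the statement that the
distributional gradient of a Lipschitz function is curl-free (`integral_hopfLax_weak`); extending `V`
by its initial values to negative times produces the initial term.

Comparison is the fact that `V₂ - V₁` is nondecreasing in `x` when its initial value is
(`monotone_hopfLax_sub`): two minimizing lines that cross may be swapped, again by convexity of `f*`.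

For integrable data the primitive is bounded, so `V` still makes sense and is Lipschitz on `t ≥ τ`
for each `τ > 0` (`exists_lipschitzWith_hopfLax_of_bounded`). Comparing the solutions with data `u₁`,
`u₂` with the one with datum `max u₁ u₂`, and using that the oscillation in `x` of a difference of
Hopf–Lax functions is at most that of the initial potentials, gives the `L¹` contraction on every time
slice (`lintegral_enorm_deriv_hopfLax_sub_le`). Hence the limit of the approximating solutions is the
Lax–Oleinik function of the limit datum itself (`IsApproximation.isLimitL1`), and the assertions on
limits are assertions on that function.
-/

namespace ScalarConservation

open scoped NNReal

variable {f v v₁ v₂ u₀ u₁ u₂ w : ℝ → ℝ}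

/-! ### The Fenchel dual of a convex superlinear function -/

lemma Superlinear.exists_mul_abs_sub_le (hs : Superlinear f) (hc : ConvexOn ℝ univ f) (R : ℝ) :
    ∃ C, ∀ p, R * |p| - C ≤ f p := by
  have hcont : Continuous f := hc.locallyLipschitz.continuous
  obtain ⟨K, hK, hKR⟩ := mem_cocompact.1 (hs.eventually_ge_atTop R)
  obtain ⟨C, hC⟩ := (hK.union isCompact_singleton).bddAbove_image (K := K ∪ {0})
    (f := fun p => R * |p| - f p) (by fun_prop)
  refine ⟨max C 0, fun p => ?_⟩
  by_cases hp : p ∈ K ∪ {0}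
  · linarith [hC (mem_image_of_mem _ hp), le_max_left C 0]
  · simp only [mem_union, mem_singleton_iff, not_or] at hp
    have h : R ≤ f p / |p| := hKR hp.1
    rw [le_div_iff₀ (abs_pos.2 hp.2)] at h
    linarith [le_max_right C 0]

lemma bddAbove_fenchelDual (hc : ConvexOn ℝ univ f) (hs : Superlinear f) (q : ℝ) :
    BddAbove (range fun p : ℝ => p * q - f p) := by
  obtain ⟨C, hC⟩ := hs.exists_mul_abs_sub_le hc |q|
  refine ⟨C, ?_⟩
  rintro _ ⟨p, rfl⟩
  have : p * q ≤ |q| * |p| := by rw [mul_comm, ← abs_mul]; exact le_abs_self _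
  linarith [hC p]

/-- Young's inequality. -/
lemma mul_sub_le_fenchelDual (hc : ConvexOn ℝ univ f) (hs : Superlinear f) (p q : ℝ) :
    p * q - f p ≤ fenchelDual f q :=
  le_ciSup (bddAbove_fenchelDual hc hs q) p

lemma convexOn_fenchelDual (hc : ConvexOn ℝ univ f) (hs : Superlinear f) :
    ConvexOn ℝ univ (fenchelDual f) := by
  refine ⟨convex_univ, fun x _ y _ a b ha hb hab => ciSup_le fun p => ?_⟩
  have h1 := mul_le_mul_of_nonneg_left (mul_sub_le_fenchelDual hc hs p x) ha
  have h2 := mul_le_mul_of_nonneg_left (mul_sub_le_fenchelDual hc hs p y) hb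
  have h3 : f p = a * f p + b * f p := by rw [← add_mul, hab, one_mul]
  simp only [smul_eq_mul]
  linarith

lemma continuous_fenchelDual (hc : ConvexOn ℝ univ f) (hs : Superlinear f) :
    Continuous (fenchelDual f) :=
  (convexOn_fenchelDual hc hs).locallyLipschitz.continuous

lemma mul_abs_sub_le_fenchelDual (hc : ConvexOn ℝ univ f) (hs : Superlinear f) (R q : ℝ) :
    R * |q| - max (f R) (f (-R)) ≤ fenchelDual f q := by
  rcases abs_cases q with ⟨h, _⟩ | ⟨h, _⟩
  · linarith [mul_sub_le_fenchelDual hc hs R q, le_max_left (f R) (f (-R)), congrArg (R * ·) h]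
  · linarith [mul_sub_le_fenchelDual hc hs (-R) q, le_max_right (f R) (f (-R)),
      congrArg (R * ·) h]

/-- Young's inequality is almost attained; this is the biconjugation inequality `f ≤ f**`. -/
lemma exists_add_fenchelDual_le (hc : ConvexOn ℝ univ f) (p : ℝ) {ε : ℝ} (hε : 0 < ε) :
    ∃ q, f p + fenchelDual f q ≤ p * q + ε := by
  have hcont : Continuous f := hc.locallyLipschitz.continuous
  obtain ⟨q, c, hq, hqc⟩ := hc.exists_affine_le_of_lt_real (x := p) (a := f p - ε) (mem_univ _)
    (by linarith) isClosed_univ (hcont.lowerSemicontinuous.lowerSemicontinuousOn _)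
  have : fenchelDual f q ≤ -c := ciSup_le fun r => by linarith [hq r (mem_univ _)]
  exact ⟨q, by linarith⟩

/-! ### The Hopf–Lax formula -/

/-- The Hopf–Lax function of the initial potential `v`, extended by `v` to `t ≤ 0`. For `t > 0` and
`v = primitive u₀` it is `valueFunction f u₀`. The extension makes it continuous up to `t = 0`,
where the infimum would involve a division by zero. -/
noncomputable def hopfLax (f v : ℝ → ℝ) (x t : ℝ) : ℝ :=
  if t ≤ 0 then v x else ⨅ y : ℝ, (v y + t * fenchelDual f ((x - y) / t))

/-- Continuous functions with at most linear decay: the initial potentials for which the infimum in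
the Hopf–Lax formula is attained. -/
structure IsPotential (v : ℝ → ℝ) : Prop where
  continuous : Continuous v
  exists_le : ∃ A M : ℝ, ∀ y, -(A + M * |y|) ≤ v y

lemma hopfLax_of_nonpos {t : ℝ} (ht : t ≤ 0) (x : ℝ) : hopfLax f v x t = v x := if_pos ht

lemma hopfLax_primitive {u₀ : ℝ → ℝ} {t : ℝ} (ht : 0 < t) (x : ℝ) :
    hopfLax f (primitive u₀) x t = valueFunction f u₀ x t := if_neg ht.not_ge

lemma IsPotential.exists_minimizer (hv : IsPotential v) (hc : ConvexOn ℝ univ f)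
    (hs : Superlinear f) {t : ℝ} (ht : 0 < t) (x : ℝ) :
    ∃ y, ∀ z, v y + t * fenchelDual f ((x - y) / t) ≤ v z + t * fenchelDual f ((x - z) / t) := by
  obtain ⟨A, M, hA⟩ := hv.exists_le
  have hL := continuous_fenchelDual hc hs
  have hvc := hv.continuous
  refine Continuous.exists_forall_le (by fun_prop) ?_
  set C := max (f (|M| + 1)) (f (-(|M| + 1)))
  have hlow : ∀ y, |y| - (A + (|M| + 1) * |x| + t * C) ≤
      v y + t * fenchelDual f ((x - y) / t) := by
    intro y
    have h1 := mul_le_mul_of_nonneg_left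
      (mul_abs_sub_le_fenchelDual hc hs (|M| + 1) ((x - y) / t)) ht.le
    have h2 : t * ((|M| + 1) * |(x - y) / t| - C) = (|M| + 1) * |x - y| - t * C := by
      rw [abs_div, abs_of_pos ht]; field_simp
    have h3 : (|M| + 1) * (|y| - |x|) ≤ (|M| + 1) * |x - y| := by
      gcongr
      linarith [abs_sub_abs_le_abs_sub y x, abs_sub_comm x y]
    have h4 : M * |y| ≤ |M| * |y| := by gcongr; exact le_abs_self M
    linarith [hA y]
  refine tendsto_atTop_mono hlow (tendsto_atTop_add_const_right _ _ ?_)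
  exact tendsto_norm_cocompact_atTop

lemma hopfLax_le (hv : IsPotential v) (hc : ConvexOn ℝ univ f) (hs : Superlinear f) {t : ℝ}
    (ht : 0 < t) (x y : ℝ) : hopfLax f v x t ≤ v y + t * fenchelDual f ((x - y) / t) := by
  obtain ⟨z, hz⟩ := hv.exists_minimizer hc hs ht x
  rw [hopfLax, if_neg ht.not_ge]
  refine ciInf_le ⟨v z + t * fenchelDual f ((x - z) / t), ?_⟩ y
  rintro _ ⟨w, rfl⟩
  exact hz w

lemma exists_hopfLax_eq (hv : IsPotential v) (hc : ConvexOn ℝ univ f) (hs : Superlinear f) {t : ℝ}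
    (ht : 0 < t) (x : ℝ) : ∃ q, hopfLax f v x t = v (x - t * q) + t * fenchelDual f q := by
  obtain ⟨y, hy⟩ := hv.exists_minimizer hc hs ht x
  have h1 : x - t * ((x - y) / t) = y := by field_simp; ring
  refine ⟨(x - y) / t, le_antisymm ?_ ?_⟩
  · rw [h1]; exact hopfLax_le hv hc hs ht x y
  · rw [h1, hopfLax, if_neg ht.not_ge]; exact le_ciInf hy

lemma hopfLax_le_sub_mul (hv : IsPotential v) (hc : ConvexOn ℝ univ f) (hs : Superlinear f)
    {t : ℝ} (ht : 0 ≤ t) (x q : ℝ) : hopfLax f v x t ≤ v (x - t * q) + t * fenchelDual f q := by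
  rcases ht.eq_or_lt with rfl | ht
  · simp [hopfLax]
  · have := hopfLax_le hv hc hs ht x (x - t * q)
    rwa [show (x - (x - t * q)) / t = q by field_simp; ring] at this

/-- One half of the dynamic programming principle: `V` increases along a straight line of slope `q`
by at most `h f*(q)`. -/
lemma hopfLax_add_le (hv : IsPotential v) (hc : ConvexOn ℝ univ f) (hs : Superlinear f) {t h : ℝ}
    (ht : 0 ≤ t) (hh : 0 ≤ h) (x q : ℝ) :
    hopfLax f v (x + h * q) (t + h) ≤ hopfLax f v x t + h * fenchelDual f q := by
  rcases ht.eq_or_lt with rfl | ht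
  · rw [hopfLax_of_nonpos le_rfl, zero_add]
    simpa using hopfLax_le_sub_mul hv hc hs hh (x + h * q) q
  obtain ⟨r, hr⟩ := exists_hopfLax_eq hv hc hs ht x
  rw [hr]
  have hth : 0 < t + h := by linarith
  have h1 := hopfLax_le_sub_mul hv hc hs hth.le (x + h * q)
    (t / (t + h) * r + h / (t + h) * q)
  have h2 : x + h * q - (t + h) * (t / (t + h) * r + h / (t + h) * q) = x - t * r := by
    field_simp; ring
  have h3 := (convexOn_fenchelDual hc hs).2 (mem_univ r) (mem_univ q)
    (div_nonneg ht.le hth.le) (div_nonneg hh hth.le) (by field_simp)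
  have h4 := mul_le_mul_of_nonneg_left h3 hth.le
  have h5 : (t + h) * ((t / (t + h)) • fenchelDual f r + (h / (t + h)) • fenchelDual f q) =
      t * fenchelDual f r + h * fenchelDual f q := by
    simp only [smul_eq_mul]; field_simp
  rw [h2] at h1
  simp only [smul_eq_mul] at h4 h5
  linarith

/-- The other half of the dynamic programming principle: through each point passes a straight line,
reaching down to `t = 0`, along which `V` grows at the rate `f*(q)`. -/
lemma exists_hopfLax_sub_add_le (hv : IsPotential v) (hc : ConvexOn ℝ univ f) (hs : Superlinear f)
    {t : ℝ} (ht : 0 < t) (x : ℝ) :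
    ∃ q, ∀ h, 0 ≤ h → h ≤ t →
      hopfLax f v (x - h * q) (t - h) + h * fenchelDual f q ≤ hopfLax f v x t := by
  obtain ⟨q, hq⟩ := exists_hopfLax_eq hv hc hs ht x
  refine ⟨q, fun h h0 h1 => ?_⟩
  have := hopfLax_le_sub_mul hv hc hs (sub_nonneg.2 h1) (x - h * q) q
  rw [show x - h * q - (t - h) * q = x - t * q by ring] at this
  rw [hq]
  linarith

/-! ### Lipschitz bounds -/

/-- A Lipschitz bound in `x` for all times `t ≥ τ` yields a Lipschitz bound in `(x, t)`; the time
`max t τ` extends the function below `τ`. -/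
lemma exists_lipschitzWith_hopfLax_max (hv : IsPotential v) (hc : ConvexOn ℝ univ f)
    (hs : Superlinear f) {τ : ℝ} (hτ : 0 ≤ τ) {K : ℝ≥0}
    (hK : ∀ t, τ ≤ t → LipschitzWith K fun x => hopfLax f v x t) :
    ∃ C, LipschitzWith C fun p : ℝ × ℝ => hopfLax f v p.1 (max p.2 τ) := by
  set D := max |fenchelDual f 0| |max (f K) (f (-K))|
  have hD : 0 ≤ D := (abs_nonneg _).trans (le_max_left _ _)
  have htime : ∀ x s t, τ ≤ s → s < t → |hopfLax f v x t - hopfLax f v x s| ≤ D * (t - s) := by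
    intro x s t hs' hst
    have h0 : 0 < t - s := sub_pos.2 hst
    have h1 := hopfLax_add_le hv hc hs (hτ.trans hs') h0.le x 0
    obtain ⟨q, hq⟩ := exists_hopfLax_sub_add_le hv hc hs (hτ.trans_lt (hs'.trans_lt hst)) x
    have h2 := hq (t - s) h0.le (by linarith)
    rw [show t - (t - s) = s by ring] at h2
    rw [show s + (t - s) = t by ring, mul_zero, add_zero] at h1
    have h3 := (le_abs_self _).trans ((hK s hs').dist_le_mul x (x - (t - s) * q))
    rw [Real.dist_eq, show x - (x - (t - s) * q) = (t - s) * q by ring, abs_mul,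
      abs_of_pos h0] at h3
    have h4 := mul_le_mul_of_nonneg_left (mul_abs_sub_le_fenchelDual hc hs K q) h0.le
    have h5 : fenchelDual f 0 ≤ D := (le_abs_self _).trans (le_max_left _ _)
    have h6 : max (f K) (f (-K)) ≤ D := (le_abs_self _).trans (le_max_right _ _)
    have h7 := mul_le_mul_of_nonneg_left h5 h0.le
    have h8 := mul_le_mul_of_nonneg_left h6 h0.le
    rw [abs_le]
    constructor <;> linarith
  have htime' : ∀ x s t, τ ≤ s → τ ≤ t →
      |hopfLax f v x t - hopfLax f v x s| ≤ D * |t - s| := by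
    intro x s t hs' ht'
    rcases lt_trichotomy s t with h | rfl | h
    · rw [abs_of_pos (sub_pos.2 h)]; exact htime x s t hs' h
    · simp
    · rw [abs_sub_comm, abs_sub_comm t, abs_of_pos (sub_pos.2 h)]; exact htime x t s ht' h
  refine ⟨K + D.toNNReal, LipschitzWith.of_dist_le_mul fun p q => ?_⟩
  have h1 := (hK (max p.2 τ) (le_max_right _ _)).dist_le_mul p.1 q.1
  have h2 := htime' q.1 (max q.2 τ) (max p.2 τ) (le_max_right _ _) (le_max_right _ _)
  have h3 : |max p.2 τ - max q.2 τ| ≤ |p.2 - q.2| := abs_max_sub_max_le_abs _ _ _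
  have h4 : |p.1 - q.1| ≤ dist p q := le_max_left _ _
  have h5 : |p.2 - q.2| ≤ dist p q := le_max_right _ _
  have h6 : D * |max p.2 τ - max q.2 τ| ≤ D * dist p q := by gcongr; exact h3.trans h5
  have h7 : K * dist p.1 q.1 ≤ K * dist p q := by gcongr; exact h4
  have h8 := dist_triangle (hopfLax f v p.1 (max p.2 τ)) (hopfLax f v q.1 (max p.2 τ))
    (hopfLax f v q.1 (max q.2 τ))
  rw [Real.dist_eq (hopfLax f v q.1 (max p.2 τ))] at h8
  push_cast [Real.coe_toNNReal _ hD]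
  linarith

lemma lipschitzWith_hopfLax_of_lipschitzWith (hv : IsPotential v) (hc : ConvexOn ℝ univ f)
    (hs : Superlinear f) {K : ℝ≥0} (hK : LipschitzWith K v) {t : ℝ} (ht : 0 ≤ t) :
    LipschitzWith K fun x => hopfLax f v x t := by
  rcases ht.eq_or_lt with rfl | ht
  · simpa [hopfLax] using hK
  refine LipschitzWith.of_le_add_mul _ fun x y => ?_
  obtain ⟨q, hq⟩ := exists_hopfLax_eq hv hc hs ht y
  have h1 := hopfLax_le_sub_mul hv hc hs ht.le x q
  have h2 := (le_abs_self _).trans (hK.dist_le_mul (x - t * q) (y - t * q))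
  rw [dist_sub_right] at h2
  linarith

/-- For a bounded potential, minimizers at times `t ≥ τ` have bounded speed `(x - y) / t`, and the
local Lipschitz bound of `f*` there is inherited by `V`. -/
lemma exists_lipschitzWith_hopfLax_of_bounded (hv : IsPotential v) (hc : ConvexOn ℝ univ f)
    (hs : Superlinear f) {B : ℝ} (hB : ∀ y, |v y| ≤ B) {τ : ℝ} (hτ : 0 < τ) :
    ∃ K : ℝ≥0, ∀ t, τ ≤ t → LipschitzWith K fun x => hopfLax f v x t := by
  have hB0 : 0 ≤ B := (abs_nonneg _).trans (hB 0)
  set R := fenchelDual f 0 + 2 * B / τ + max (f 1) (f (-1)) with hR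
  obtain ⟨K, hK⟩ := LocallyLipschitzOn.exists_lipschitzOnWith_of_compact
    (isCompact_Icc (a := -(R + 1)) (b := R + 1))
    (convexOn_fenchelDual hc hs).locallyLipschitz.locallyLipschitzOn
  have hK' : 0 ≤ 2 * B / τ := by positivity
  refine ⟨K + (2 * B / τ).toNNReal, fun t hτt => ?_⟩
  have ht : 0 < t := hτ.trans_le hτt
  refine LipschitzWith.of_le_add_mul _ fun x y => ?_
  obtain ⟨q, hq⟩ := exists_hopfLax_eq hv hc hs ht y
  have h1 := hopfLax_le_sub_mul hv hc hs ht.le y 0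
  have h2 := abs_le.1 (hB (y - t * q))
  have h3 := abs_le.1 (hB (y - t * 0))
  have hqR : |q| ≤ R := by
    have h4 : fenchelDual f q ≤ fenchelDual f 0 + 2 * B / t := by
      rw [← sub_le_iff_le_add', le_div_iff₀ ht]
      linarith
    have h5 : 2 * B / t ≤ 2 * B / τ := by gcongr
    have h6 := mul_abs_sub_le_fenchelDual hc hs 1 q
    linarith
  have hq2 := abs_le.1 hqR
  rw [hq]
  push_cast [Real.coe_toNNReal _ hK']
  by_cases hxy : dist x y ≤ t
  · have h7 := hopfLax_le hv hc hs ht x (y - t * q)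
    have h8 : (x - (y - t * q)) / t = q + (x - y) / t := by field_simp; ring
    have h9 : |(x - y) / t| ≤ 1 := by
      rw [abs_div, abs_of_pos ht, div_le_one ht]; exact hxy
    have h9' := abs_le.1 h9
    have h10 := (le_abs_self _).trans (hK.dist_le_mul (q + (x - y) / t)
      ⟨by linarith, by linarith⟩ q ⟨by linarith, by linarith⟩)
    rw [Real.dist_eq, add_sub_cancel_left, abs_div, abs_of_pos ht] at h10
    have h11 := mul_le_mul_of_nonneg_left h10 ht.le
    rw [show t * (K * (|x - y| / t)) = K * |x - y| by field_simp] at h11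
    rw [h8] at h7
    have h12 : 0 ≤ 2 * B / τ * dist x y := by positivity
    rw [Real.dist_eq] at h12 ⊢
    linarith
  · have h7 := hopfLax_le_sub_mul hv hc hs ht.le x q
    have h8 := abs_le.1 (hB (x - t * q))
    have h9 : 2 * B ≤ 2 * B / τ * dist x y := by
      rw [div_mul_eq_mul_div, le_div_iff₀ hτ]
      gcongr
      linarith
    have h10 : 0 ≤ (K : ℝ) * dist x y := by positivity
    linarith

/-! ### The Hamilton–Jacobi equation and comparison -/

/-- At points of differentiability the Hopf–Lax function solves `V_t + f(V_x) = 0`. -/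
lemma hamiltonJacobi (hv : IsPotential v) (hc : ConvexOn ℝ univ f) (hs : Superlinear f)
    {x t : ℝ} (ht : 0 < t) {F : ℝ × ℝ →L[ℝ] ℝ}
    (hF : HasFDerivAt (fun p : ℝ × ℝ => hopfLax f v p.1 p.2) F (x, t)) :
    F (0, 1) = -f (F (1, 0)) := by
  have hline : ∀ q, HasDerivAt (fun h : ℝ => hopfLax f v (x + h * q) (t + h))
      (q * F (1, 0) + F (0, 1)) 0 := by
    intro q
    have h1 : HasDerivAt (fun h : ℝ => ((x + h * q, t + h) : ℝ × ℝ)) (q, 1) 0 := by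
      refine HasDerivAt.prodMk ?_ ((hasDerivAt_id 0).const_add t)
      simpa using ((hasDerivAt_id (0 : ℝ)).mul_const q).const_add x
    have h2 : HasFDerivAt (fun p : ℝ × ℝ => hopfLax f v p.1 p.2) F (x + 0 * q, t + 0) := by
      simpa using hF
    have h3 := h2.comp_hasDerivAt (0 : ℝ) h1
    have h4 : F (q, 1) = q * F (1, 0) + F (0, 1) := by
      rw [show ((q, 1) : ℝ × ℝ) = q • (1, 0) + (0, 1) by simp, map_add, map_smul, smul_eq_mul]
    rwa [h4] at h3
  apply le_antisymm
  · refine le_of_forall_pos_le_add fun ε hε => ?_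
    obtain ⟨q, hq⟩ := exists_add_fenchelDual_le hc (F (1, 0)) hε
    have hle : q * F (1, 0) + F (0, 1) ≤ fenchelDual f q := by
      refine le_of_tendsto (hline q).tendsto_slope_zero_right ?_
      filter_upwards [self_mem_nhdsWithin] with h (hh : 0 < h)
      have := hopfLax_add_le hv hc hs ht.le hh.le x q
      simp only [zero_add, zero_mul, add_zero, smul_eq_mul]
      rw [inv_mul_le_iff₀ hh]
      linarith
    linarith
  · obtain ⟨q, hq⟩ := exists_hopfLax_sub_add_le hv hc hs ht x
    have hle : fenchelDual f q ≤ q * F (1, 0) + F (0, 1) := by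
      refine ge_of_tendsto (hline q).tendsto_slope_zero_left ?_
      filter_upwards [Ioo_mem_nhdsLT (neg_lt_zero.2 ht)] with h hh
      have := hq (-h) (by linarith [hh.2]) (by linarith [hh.1])
      rw [show x - -h * q = x + h * q by ring, sub_neg_eq_add] at this
      simp only [zero_add, zero_mul, add_zero, smul_eq_mul]
      rw [← neg_mul_neg, ← inv_neg, le_inv_mul_iff₀ (by linarith [hh.2])]
      linarith
    linarith [mul_sub_le_fenchelDual hc hs (F (1, 0)) q]

/-- Comparison for potentials. If the minimizing lines do not cross, they are used for the other
potential; if they cross, they are swapped, which is admissible because `f*` is convex. -/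
lemma monotone_hopfLax_sub (hv₁ : IsPotential v₁) (hv₂ : IsPotential v₂)
    (hc : ConvexOn ℝ univ f) (hs : Superlinear f) (hmono : Monotone fun y => v₂ y - v₁ y) {t : ℝ}
    (ht : 0 ≤ t) : Monotone fun x => hopfLax f v₂ x t - hopfLax f v₁ x t := by
  rcases ht.eq_or_lt with rfl | ht
  · simpa [hopfLax] using hmono
  intro x z hxz
  obtain ⟨q, hq⟩ := exists_hopfLax_eq hv₁ hc hs ht x
  obtain ⟨r, hr⟩ := exists_hopfLax_eq hv₂ hc hs ht z
  simp only
  rcases le_total (x - t * q) (z - t * r) with h | h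
  · have h1 := hopfLax_le_sub_mul hv₂ hc hs ht.le x q
    have h2 := hopfLax_le_sub_mul hv₁ hc hs ht.le z r
    have h3 := hmono h
    simp only at h3
    linarith
  · have h1 := hopfLax_le hv₂ hc hs ht x (z - t * r)
    have h2 := hopfLax_le hv₁ hc hs ht z (x - t * q)
    set a := (x - (z - t * r)) / t
    set b := (z - (x - t * q)) / t
    have hab : a + b = q + r := by simp only [a, b]; field_simp; ring
    have hqa : q ≤ a := by simp only [a]; rw [le_div_iff₀ ht]; linarith
    have har : a ≤ r := by simp only [a]; rw [div_le_iff₀ ht]; linarith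
    -- `a` and `b` lie between `q` and `r` and have the same sum
    have h3 : fenchelDual f a + fenchelDual f b ≤ fenchelDual f q + fenchelDual f r := by
      rcases hqa.eq_or_lt with h0 | h0
      · rw [← h0, show b = r by linarith]
      have hqr : 0 < r - q := by linarith
      have w1 : 0 ≤ (r - a) / (r - q) := div_nonneg (by linarith) hqr.le
      have w2 : 0 ≤ (a - q) / (r - q) := div_nonneg (by linarith) hqr.le
      have e3 : (r - a) / (r - q) + (a - q) / (r - q) = 1 := by field_simp; ring
      have e1 := (convexOn_fenchelDual hc hs).2 (mem_univ q) (mem_univ r) w1 w2 e3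
      have e2 := (convexOn_fenchelDual hc hs).2 (mem_univ q) (mem_univ r) w2 w1
        (by rw [add_comm, e3])
      simp only [smul_eq_mul] at e1 e2
      rw [show (r - a) / (r - q) * q + (a - q) / (r - q) * r = a by field_simp; ring] at e1
      rw [show (a - q) / (r - q) * q + (r - a) / (r - q) * r = b by
        rw [eq_sub_of_add_eq' hab]; field_simp; ring] at e2
      have e4 := congrArg (· * fenchelDual f q) e3
      have e5 := congrArg (· * fenchelDual f r) e3
      simp only [add_mul, one_mul] at e4 e5
      linarith
    have h4 := mul_le_mul_of_nonneg_left h3 ht.le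
    linarith

lemma hopfLax_le_hopfLax_add (hv₁ : IsPotential v₁) (hv₂ : IsPotential v₂)
    (hc : ConvexOn ℝ univ f) (hs : Superlinear f) {c : ℝ} (h : ∀ y, v₁ y ≤ v₂ y + c) {t : ℝ}
    (ht : 0 ≤ t) (x : ℝ) : hopfLax f v₁ x t ≤ hopfLax f v₂ x t + c := by
  rcases ht.eq_or_lt with rfl | ht
  · simpa [hopfLax] using h x
  obtain ⟨q, hq⟩ := exists_hopfLax_eq hv₂ hc hs ht x
  linarith [hopfLax_le_sub_mul hv₁ hc hs ht.le x q, h (x - t * q)]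

/-- The initial potential is attained as `t → 0`. -/
lemma tendsto_hopfLax (hv : IsPotential v) (hc : ConvexOn ℝ univ f) (hs : Superlinear f) {B : ℝ}
    (hB : ∀ y, |v y| ≤ B) (x : ℝ) : Tendsto (hopfLax f v x) (𝓝[>] 0) (𝓝 (v x)) := by
  rw [Metric.tendsto_nhds]
  intro ε hε
  obtain ⟨δ, hδ, hvδ⟩ := Metric.continuousAt_iff.1 (hv.continuous.continuousAt (x := x)) (ε / 2)
    (half_pos hε)
  have hB0 : 0 ≤ B := (abs_nonneg _).trans (hB 0)
  -- with this slope the penalty outweighs the gain of leaving the `δ`-neighbourhood of `x`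
  set R := 2 * B / δ
  have hR : 0 ≤ R := by positivity
  set C := max (f R) (f (-R))
  have hsmall : ∀ a : ℝ, ∀ᶠ t in 𝓝[>] (0 : ℝ), t * a < ε / 2 := fun a => by
    have : Tendsto (fun t : ℝ => t * a) (𝓝[>] 0) (𝓝 0) := by
      simpa using ((continuous_mul_const a).tendsto 0).mono_left nhdsWithin_le_nhds
    exact this.eventually_lt_const (half_pos hε)
  filter_upwards [self_mem_nhdsWithin, hsmall (fenchelDual f 0), hsmall C] with t (ht : 0 < t) h1 h2
  have h3 := hopfLax_le_sub_mul hv hc hs ht.le x 0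
  obtain ⟨q, hq⟩ := exists_hopfLax_eq hv hc hs ht x
  have h4 := mul_le_mul_of_nonneg_left (mul_abs_sub_le_fenchelDual hc hs R q) ht.le
  have h5 : v x - ε / 2 ≤ v (x - t * q) + t * (R * |q|) := by
    by_cases hd : t * |q| < δ
    · have h6 : dist (x - t * q) x < δ := by
        rwa [Real.dist_eq, sub_sub_cancel_left, abs_neg, abs_mul, abs_of_pos ht]
      have h7 := abs_lt.1 (hvδ h6)
      have h8 : 0 ≤ t * (R * |q|) := by positivity
      linarith
    · have h6 : R * δ ≤ R * (t * |q|) := by gcongr; linarith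
      have h7 : R * δ = 2 * B := by simp only [R]; field_simp
      have h8 := abs_le.1 (hB x)
      have h9 := abs_le.1 (hB (x - t * q))
      linarith
  rw [mul_zero, sub_zero] at h3
  rw [Real.dist_eq, abs_lt]
  constructor <;> linarith

/-! ### Integration by parts for Lipschitz functions on the plane -/

lemma integrable_fderiv_mul {G : ℝ × ℝ → ℝ} {C : ℝ≥0} (hG : LipschitzWith C G) {ψ : ℝ × ℝ → ℝ}
    (hψ : Continuous ψ) (hψc : HasCompactSupport ψ) (w : ℝ × ℝ) :
    Integrable fun p => fderiv ℝ G p w * ψ p := by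
  refine (hψ.integrable_of_hasCompactSupport hψc).bdd_mul (c := C * ‖w‖)
    (measurable_fderiv_apply_const ℝ G w).aestronglyMeasurable (Eventually.of_forall fun p => ?_)
  exact (fderiv ℝ G p).le_of_opNorm_le (norm_fderiv_le_of_lipschitz ℝ hG) w

lemma integral_fderiv_mul {G : ℝ × ℝ → ℝ} {C : ℝ≥0} (hG : LipschitzWith C G) {ψ : ℝ × ℝ → ℝ}
    (hψ : ContDiff ℝ 1 ψ) (hψc : HasCompactSupport ψ) (w : ℝ × ℝ) :
    ∫ p, fderiv ℝ G p w * ψ p = -∫ p, fderiv ℝ ψ p w * G p := by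
  obtain ⟨D, hD⟩ := ContDiff.lipschitzWith_of_hasCompactSupport hψc hψ one_ne_zero
  have h := LipschitzWith.integral_lineDeriv_mul_eq (μ := volume) hG hD hψc w
  rw [← integral_neg]
  convert h using 1
  · refine integral_congr_ae ?_
    filter_upwards [hG.ae_differentiableAt (μ := volume)] with p hp
    simp only [hp.lineDeriv_eq_fderiv]
  · refine integral_congr_ae (Eventually.of_forall fun p => ?_)
    simp only [(hψ.differentiable one_ne_zero p).lineDeriv_eq_fderiv, map_neg, neg_mul]

lemma contDiff_partialT {φ : ℝ × ℝ → ℝ} (hφ : ContDiff ℝ ∞ φ) : ContDiff ℝ ∞ (partialT φ) :=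
  (hφ.fderiv_right (m := ∞) (by simp)).clm_apply contDiff_const

lemma contDiff_partialX {φ : ℝ × ℝ → ℝ} (hφ : ContDiff ℝ ∞ φ) : ContDiff ℝ ∞ (partialX φ) :=
  (hφ.fderiv_right (m := ∞) (by simp)).clm_apply contDiff_const

/-- A Lipschitz function has a curl-free gradient in the sense of distributions. -/
lemma integral_fderiv_mul_partialT_eq {G : ℝ × ℝ → ℝ} {C : ℝ≥0} (hG : LipschitzWith C G)
    {φ : ℝ × ℝ → ℝ} (hφ : ContDiff ℝ ∞ φ) (hφc : HasCompactSupport φ) :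
    ∫ p, fderiv ℝ G p (1, 0) * partialT φ p = ∫ p, fderiv ℝ G p (0, 1) * partialX φ p := by
  rw [integral_fderiv_mul hG ((contDiff_partialT hφ).of_le (by simp)) (hφc.fderiv_apply ℝ _),
    integral_fderiv_mul hG ((contDiff_partialX hφ).of_le (by simp)) (hφc.fderiv_apply ℝ _)]
  congr 2
  ext p
  have hd : DifferentiableAt ℝ (fderiv ℝ φ) p :=
    (hφ.fderiv_right (m := ∞) (by simp)).differentiable (by simp) p
  have h1 : ∀ w w' : ℝ × ℝ, fderiv ℝ (fun p => fderiv ℝ φ p w) p w' =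
      fderiv ℝ (fderiv ℝ φ) p w' w := fun w w' => by
    rw [fderiv_clm_apply hd (differentiableAt_const w)]
    simp
  have hsymm := (hφ.contDiffAt (x := p)).isSymmSndFDerivAt
    (by simpa using WithTop.coe_le_coe.2 (le_top (a := (2 : ℕ∞))))
  change fderiv ℝ (fun p => fderiv ℝ φ p (0, 1)) p (1, 0) * _ =
    fderiv ℝ (fun p => fderiv ℝ φ p (1, 0)) p (0, 1) * _
  rw [h1, h1, hsymm.eq]

lemma _root_.DifferentiableAt.hasDerivAt_fst {G : ℝ × ℝ → ℝ} {p : ℝ × ℝ}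
    (h : DifferentiableAt ℝ G p) :
    HasDerivAt (fun x => G (x, p.2)) (fderiv ℝ G p (1, 0)) p.1 :=
  h.hasFDerivAt.comp_hasDerivAt (f := fun x => (x, p.2)) p.1
    ((hasDerivAt_id p.1).prodMk (hasDerivAt_const _ _))

lemma _root_.DifferentiableAt.hasDerivAt_snd {G : ℝ × ℝ → ℝ} {p : ℝ × ℝ}
    (h : DifferentiableAt ℝ G p) :
    HasDerivAt (fun t => G (p.1, t)) (fderiv ℝ G p (0, 1)) p.2 :=
  h.hasFDerivAt.comp_hasDerivAt (f := fun t => (p.1, t)) p.2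
    ((hasDerivAt_const _ _).prodMk (hasDerivAt_id p.2))

lemma setIntegral_Iic_partialT {φ : ℝ × ℝ → ℝ} (hφ : ContDiff ℝ ∞ φ) (hφc : HasCompactSupport φ)
    (x τ : ℝ) : ∫ t in Iic τ, partialT φ (x, t) = φ (x, τ) := by
  have h1 : ContDiff ℝ 1 fun t => φ (x, t) :=
    (hφ.of_le (by simp)).comp (contDiff_const.prodMk contDiff_id)
  have h2 : HasCompactSupport fun t => φ (x, t) := by
    refine HasCompactSupport.intro (hφc.isCompact.image continuous_snd) fun t ht => ?_
    by_contra h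
    exact ht ⟨(x, t), subset_tsupport _ h, rfl⟩
  rw [← h2.integral_Iic_deriv_eq h1 τ]
  congr 1
  ext t
  exact ((hφ.differentiable (by simp) (x, t)).hasDerivAt_snd).deriv.symm

/-! ### The conservation law satisfied by the space derivative -/

lemma ae_snd_ne (τ : ℝ) : ∀ᵐ p : ℝ × ℝ, p.2 ≠ τ := by
  rw [ae_iff, show {p : ℝ × ℝ | ¬ p.2 ≠ τ} = univ ×ˢ {τ} by ext; simp, Measure.volume_eq_prod,
    Measure.prod_prod]
  simp

/-- Almost everywhere above time `τ` the function `V` is differentiable in `x` and its gradient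
solves the Hamilton–Jacobi equation; `max p.2 τ` extends `V` to a Lipschitz function. -/
lemma ae_hasDerivAt_hopfLax (hv : IsPotential v) (hc : ConvexOn ℝ univ f) (hs : Superlinear f)
    {τ : ℝ} (hτ : 0 ≤ τ) {C : ℝ≥0}
    (hC : LipschitzWith C fun p : ℝ × ℝ => hopfLax f v p.1 (max p.2 τ)) :
    ∀ᵐ p : ℝ × ℝ, τ < p.2 →
      HasDerivAt (fun x => hopfLax f v x p.2)
        (fderiv ℝ (fun p : ℝ × ℝ => hopfLax f v p.1 (max p.2 τ)) p (1, 0)) p.1 ∧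
      fderiv ℝ (fun p : ℝ × ℝ => hopfLax f v p.1 (max p.2 τ)) p (0, 1) =
        -f (deriv (fun x => hopfLax f v x p.2) p.1) := by
  filter_upwards [hC.ae_differentiableAt (μ := volume)] with p hp hpτ
  have h1 := hp.hasDerivAt_fst
  simp only [max_eq_left hpτ.le] at h1
  refine ⟨h1, ?_⟩
  rw [h1.deriv]
  refine hamiltonJacobi hv hc hs (x := p.1) (t := p.2) (hτ.trans_lt hpτ)
    (hp.hasFDerivAt.congr_of_eventuallyEq ?_)
  filter_upwards [continuous_snd.continuousAt.eventually (lt_mem_nhds hpτ)] with q hq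
  simp only [max_eq_left (le_of_lt hq)]

lemma integral_hopfLax_weak (hv : IsPotential v) (hc : ConvexOn ℝ univ f) (hs : Superlinear f)
    {τ : ℝ} (hτ : 0 ≤ τ) {K : ℝ≥0}
    (hK : ∀ t, τ ≤ t → LipschitzWith K fun x => hopfLax f v x t)
    {φ : ℝ × ℝ → ℝ} (hφ : ContDiff ℝ ∞ φ) (hφc : HasCompactSupport φ) :
    (∫ p in univ ×ˢ Ioi τ, (deriv (fun x => hopfLax f v x p.2) p.1 * partialT φ p
        + f (deriv (fun x => hopfLax f v x p.2) p.1) * partialX φ p))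
      + ∫ x, deriv (fun x => hopfLax f v x τ) x * φ (x, τ) = 0 := by
  obtain ⟨C, hC⟩ := exists_lipschitzWith_hopfLax_max hv hc hs hτ hK
  set G := fun p : ℝ × ℝ => hopfLax f v p.1 (max p.2 τ)
  have i1 := integrable_fderiv_mul hC (contDiff_partialT hφ).continuous
    (hφc.fderiv_apply ℝ (0, 1)) (1, 0)
  have i2 := integrable_fderiv_mul hC (contDiff_partialX hφ).continuous
    (hφc.fderiv_apply ℝ (1, 0)) (0, 1)
  have h0 : ∫ p, (fderiv ℝ G p (1, 0) * partialT φ p - fderiv ℝ G p (0, 1) * partialX φ p) = 0 := by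
    rw [integral_sub i1 i2, integral_fderiv_mul_partialT_eq hC hφ hφc, sub_self]
  have hcompl : (univ ×ˢ Ioi τ : Set (ℝ × ℝ))ᶜ = univ ×ˢ Iic τ := by ext; simp
  have hmeas : MeasurableSet (univ ×ˢ Ioi τ : Set (ℝ × ℝ)) :=
    MeasurableSet.univ.prod measurableSet_Ioi
  have hmeas' : MeasurableSet (univ ×ˢ Iic τ : Set (ℝ × ℝ)) :=
    MeasurableSet.univ.prod measurableSet_Iic
  have i12 : Integrable fun p =>
      fderiv ℝ G p (1, 0) * partialT φ p - fderiv ℝ G p (0, 1) * partialX φ p := i1.sub i2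
  rw [← integral_add_compl hmeas i12, hcompl] at h0
  rw [← h0]
  congr 1
  · refine integral_congr_ae ?_
    rw [EventuallyEq, ae_restrict_iff' hmeas]
    filter_upwards [ae_hasDerivAt_hopfLax hv hc hs hτ hC] with p hp hpτ
    obtain ⟨h1, h2⟩ := hp hpτ.2
    rw [h2, h1.deriv]
    ring
  · -- below `τ` the extension does not depend on time, so only the first term survives
    have h1 : (fun p => fderiv ℝ G p (1, 0) * partialT φ p - fderiv ℝ G p (0, 1) * partialX φ p)
        =ᵐ[volume.restrict (univ ×ˢ Iic τ)]
        fun p => deriv (fun x => hopfLax f v x τ) p.1 * partialT φ p := by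
      rw [EventuallyEq, ae_restrict_iff' hmeas']
      filter_upwards [hC.ae_differentiableAt (μ := volume), ae_snd_ne τ] with p hp hne hpτ
      have hlt : p.2 < τ := lt_of_le_of_ne hpτ.2 hne
      have h2 := hp.hasDerivAt_fst
      have h3 := hp.hasDerivAt_snd
      simp only [G, max_eq_right hlt.le] at h2
      have h4 : (fun t => G (p.1, t)) =ᶠ[𝓝 p.2] fun _ => hopfLax f v p.1 τ := by
        filter_upwards [gt_mem_nhds hlt] with t ht
        simp only [G, max_eq_right (le_of_lt ht)]
      rw [h2.deriv, ← h3.deriv, h4.deriv_eq, deriv_const]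
      ring
    have i3 := (i12.integrableOn (s := univ ×ˢ Iic τ)).congr h1
    rw [integral_congr_ae h1, Measure.volume_eq_prod, setIntegral_prod _ i3, setIntegral_univ]
    refine integral_congr_ae (Eventually.of_forall fun x => ?_)
    simp only
    rw [integral_const_mul, setIntegral_Iic_partialT hφ hφc]

/-! ### Primitives as potentials -/

lemma IsPotential.of_lipschitzWith {K : ℝ≥0} (h : LipschitzWith K v) : IsPotential v := by
  refine ⟨h.continuous, |v 0|, K, fun y => ?_⟩
  have h1 := abs_le.1 (h.dist_le_mul y 0)
  rw [Real.dist_eq, sub_zero] at h1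
  linarith [neg_abs_le (v 0)]

lemma IsPotential.of_bounded (hcont : Continuous v) {B : ℝ} (h : ∀ y, |v y| ≤ B) :
    IsPotential v :=
  ⟨hcont, B, 0, fun y => by linarith [neg_abs_le (v y), h y]⟩

lemma _root_.MeasureTheory.LocallyIntegrable.intervalIntegrable_volume {u : ℝ → ℝ}
    (hu : LocallyIntegrable u) (x y : ℝ) : IntervalIntegrable u volume x y :=
  intervalIntegrable_iff.2 ((hu.integrableOn_isCompact isCompact_uIcc).mono_set uIoc_subset_uIcc)

lemma primitive_sub_primitive {u : ℝ → ℝ} (hu : LocallyIntegrable u) (x y : ℝ) :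
    primitive u y - primitive u x = ∫ s in x..y, u s :=
  intervalIntegral.integral_interval_sub_left
    (hu.intervalIntegrable_volume _ _) (hu.intervalIntegrable_volume _ _)

lemma exists_lipschitzWith_primitive {u : ℝ → ℝ} (hu : MemLp u ⊤ volume) :
    ∃ K, LipschitzWith K (primitive u) := by
  set K := (eLpNormEssSup u volume).toNNReal
  have hfin : eLpNormEssSup u volume ≠ ⊤ := by
    have := hu.2
    rw [eLpNorm_exponent_top] at this
    exact this.ne
  refine ⟨K, LipschitzWith.of_dist_le_mul fun x y => ?_⟩
  rw [dist_comm, dist_comm x, Real.dist_eq, Real.dist_eq,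
    primitive_sub_primitive (hu.locallyIntegrable le_top), ← Real.norm_eq_abs]
  refine intervalIntegral.norm_integral_le_of_norm_le_const_ae ?_
  filter_upwards [ae_le_eLpNormEssSup (f := u) (μ := volume)] with s hs' _
  rw [← ENNReal.coe_toNNReal hfin, enorm_le_coe] at hs'
  exact hs'

lemma continuous_primitive_of_locallyIntegrable {u : ℝ → ℝ} (hu : LocallyIntegrable u) :
    Continuous (primitive u) :=
  intervalIntegral.continuous_primitive hu.intervalIntegrable_volume 0

lemma abs_primitive_le {u : ℝ → ℝ} (hu : Integrable u) (x : ℝ) :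
    |primitive u x| ≤ ∫ s, |u s| := by
  rw [primitive, ← Real.norm_eq_abs]
  refine (intervalIntegral.norm_integral_le_integral_norm_uIoc).trans ?_
  exact setIntegral_le_integral hu.norm (Eventually.of_forall fun _ => norm_nonneg _)

lemma isPotential_primitive_of_integrable {u : ℝ → ℝ} (hu : Integrable u) :
    IsPotential (primitive u) :=
  .of_bounded (continuous_primitive_of_locallyIntegrable hu.locallyIntegrable) (abs_primitive_le hu)

lemma isPotential_primitive_of_memLp_top {u : ℝ → ℝ} (hu : MemLp u ⊤ volume) :
    IsPotential (primitive u) :=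
  .of_lipschitzWith (exists_lipschitzWith_primitive hu).choose_spec

lemma laxOleinik_eq_deriv_hopfLax {u₀ : ℝ → ℝ} {p : ℝ × ℝ} (hp : 0 < p.2) :
    laxOleinik f u₀ p = deriv (fun x => hopfLax f (primitive u₀) x p.2) p.1 := by
  simp only [hopfLax_primitive hp, laxOleinik]

/-! ### Contraction in `L¹` on time slices -/

lemma primitive_sub (hw : Integrable w) (hu : Integrable u₁) (x : ℝ) :
    primitive w x - primitive u₁ x = primitive (w - u₁) x :=
  (intervalIntegral.integral_sub hw.intervalIntegrable hu.intervalIntegrable).symm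

lemma monotone_primitive_sub (hu₁ : LocallyIntegrable u₁) (hu₂ : LocallyIntegrable u₂)
    (h : ∀ᵐ x, u₁ x ≤ u₂ x) : Monotone fun x => primitive u₂ x - primitive u₁ x := by
  intro x y hxy
  have h1 := intervalIntegral.integral_mono_ae hxy (hu₁.intervalIntegrable_volume x y)
    (hu₂.intervalIntegrable_volume x y) h
  rw [← primitive_sub_primitive hu₁, ← primitive_sub_primitive hu₂] at h1
  simp only
  linarith

/-- If `u₁ ≤ w` then the oscillation in `x` of the difference of the two Hopf–Lax functions is at
most the mass `∫ (w - u₁)` of the difference of the data. -/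
lemma hopfLax_sub_sub_le (hc : ConvexOn ℝ univ f) (hs : Superlinear f) (hu : Integrable u₁)
    (hw : Integrable w) (h : ∀ x, u₁ x ≤ w x) {t : ℝ} (ht : 0 ≤ t) (x y : ℝ) :
    (hopfLax f (primitive w) y t - hopfLax f (primitive u₁) y t) -
      (hopfLax f (primitive w) x t - hopfLax f (primitive u₁) x t) ≤ ∫ s, (w s - u₁ s) := by
  have hpu := isPotential_primitive_of_integrable hu
  have hpw := isPotential_primitive_of_integrable hw
  have hd : Integrable (w - u₁) := hw.sub hu
  have hd0 : ∀ s, 0 ≤ (w - u₁) s := fun s => sub_nonneg.2 (h s)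
  have hpos : 0 ≤ ∫ s in Ioi 0, (w - u₁) s := integral_nonneg hd0
  have hneg : 0 ≤ ∫ s in Iic 0, (w - u₁) s := integral_nonneg hd0
  have hbound : ∀ z, primitive (w - u₁) z ≤ ∫ s in Ioi 0, (w - u₁) s ∧
      -∫ s in Iic 0, (w - u₁) s ≤ primitive (w - u₁) z := by
    intro z
    rcases le_total 0 z with hz | hz
    · rw [primitive, intervalIntegral.integral_of_le hz]
      have h1 : 0 ≤ ∫ s in Ioc 0 z, (w - u₁) s := integral_nonneg hd0
      exact ⟨setIntegral_mono_set hd.integrableOn (Eventually.of_forall hd0)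
        Ioc_subset_Ioi_self.eventuallyLE, by linarith⟩
    · rw [primitive, intervalIntegral.integral_of_ge hz]
      have h1 : 0 ≤ ∫ s in Ioc z 0, (w - u₁) s := integral_nonneg hd0
      exact ⟨by linarith, neg_le_neg (setIntegral_mono_set hd.integrableOn
        (Eventually.of_forall hd0) Ioc_subset_Iic_self.eventuallyLE)⟩
  have htotal := intervalIntegral.integral_Iic_add_Ioi (b := 0) hd.integrableOn hd.integrableOn
  have h1 := hopfLax_le_hopfLax_add hpw hpu hc hs (c := ∫ s in Ioi 0, (w - u₁) s)
    (fun z => by linarith [primitive_sub hw hu z, (hbound z).1]) ht y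
  have h2 := hopfLax_le_hopfLax_add hpu hpw hc hs (c := ∫ s in Iic 0, (w - u₁) s)
    (fun z => by linarith [primitive_sub hw hu z, (hbound z).2]) ht x
  change _ ≤ ∫ s, (w - u₁) s
  linarith

lemma exists_lipschitzWith_hopfLax_primitive (hc : ConvexOn ℝ univ f) (hs : Superlinear f)
    (hu : Integrable u₀) {τ : ℝ} (hτ : 0 < τ) :
    ∃ K : ℝ≥0, ∀ t, τ ≤ t → LipschitzWith K fun x => hopfLax f (primitive u₀) x t :=
  exists_lipschitzWith_hopfLax_of_bounded (isPotential_primitive_of_integrable hu) hc hs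
    (abs_primitive_le hu) hτ

/-- Contraction on time slices: comparison of both solutions with the one whose datum is
`max u₁ u₂` bounds `|u₁ - u₂|` by a function whose mass is at most that at time zero. -/
lemma lintegral_enorm_deriv_hopfLax_sub_le (hc : ConvexOn ℝ univ f) (hs : Superlinear f)
    (hu₁ : Integrable u₁) (hu₂ : Integrable u₂) {t : ℝ} (ht : 0 < t) :
    ∫⁻ x, ‖deriv (fun x => hopfLax f (primitive u₁) x t) x -
      deriv (fun x => hopfLax f (primitive u₂) x t) x‖ₑ ≤ ∫⁻ x, ‖u₁ x - u₂ x‖ₑ := by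
  have hw : Integrable fun x => max (u₁ x) (u₂ x) := hu₁.sup hu₂
  set H := fun (u : ℝ → ℝ) (x : ℝ) => hopfLax f (primitive u) x t
  set W := fun x => max (u₁ x) (u₂ x)
  obtain ⟨K₁, hK₁⟩ := exists_lipschitzWith_hopfLax_primitive hc hs hu₁ ht
  obtain ⟨K₂, hK₂⟩ := exists_lipschitzWith_hopfLax_primitive hc hs hu₂ ht
  obtain ⟨K, hK⟩ := exists_lipschitzWith_hopfLax_primitive hc hs hw ht
  replace hK₁ : LipschitzWith K₁ (H u₁) := hK₁ t le_rfl
  replace hK₂ : LipschitzWith K₂ (H u₂) := hK₂ t le_rfl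
  replace hK : LipschitzWith K (H W) := hK t le_rfl
  have hS : LipschitzWith _ ((H W - H u₁) + (H W - H u₂)) := (hK.sub hK₁).add (hK.sub hK₂)
  have hm₁ : Monotone (H W - H u₁) := monotone_hopfLax_sub
    (isPotential_primitive_of_integrable hu₁) (isPotential_primitive_of_integrable hw) hc hs
    (monotone_primitive_sub hu₁.locallyIntegrable hw.locallyIntegrable
      (Eventually.of_forall fun _ => le_max_left _ _)) ht.le
  have hm₂ : Monotone (H W - H u₂) := monotone_hopfLax_sub
    (isPotential_primitive_of_integrable hu₂) (isPotential_primitive_of_integrable hw) hc hs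
    (monotone_primitive_sub hu₂.locallyIntegrable hw.locallyIntegrable
      (Eventually.of_forall fun _ => le_max_right _ _)) ht.le
  set S := (H W - H u₁) + (H W - H u₂)
  have hSm : Monotone S := hm₁.add hm₂
  have hae : ∀ᵐ x, ‖deriv (H u₁) x - deriv (H u₂) x‖ₑ ≤ ENNReal.ofReal (deriv S x) := by
    filter_upwards [hK₁.ae_differentiableAt_real, hK₂.ae_differentiableAt_real,
      hK.ae_differentiableAt_real] with x h1 h2 h3
    have d1 : deriv (H W - H u₁) x = deriv (H W) x - deriv (H u₁) x := deriv_sub h3 h1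
    have d2 : deriv (H W - H u₂) x = deriv (H W) x - deriv (H u₂) x := deriv_sub h3 h2
    have d3 : deriv S x = deriv (H W - H u₁) x + deriv (H W - H u₂) x :=
      deriv_add (h3.sub h1) (h3.sub h2)
    have p1 := hm₁.deriv_nonneg (x := x)
    have p2 := hm₂.deriv_nonneg (x := x)
    rw [← ofReal_norm, Real.norm_eq_abs]
    refine ENNReal.ofReal_le_ofReal (abs_le.2 ⟨?_, ?_⟩) <;> linarith
  have hmass : ∀ a b, S b - S a ≤ ∫ x, |u₁ x - u₂ x| := by
    intro a b
    have h1 := hopfLax_sub_sub_le hc hs hu₁ hw (fun _ => le_max_left _ _) ht.le a b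
    have h2 := hopfLax_sub_sub_le hc hs hu₂ hw (fun _ => le_max_right _ _) ht.le a b
    have h3 : ∫ x, |u₁ x - u₂ x| = (∫ x, (W x - u₁ x)) + ∫ x, (W x - u₂ x) := by
      rw [← integral_add (f := fun x => W x - u₁ x) (g := fun x => W x - u₂ x)
        (hw.sub hu₁) (hw.sub hu₂)]
      refine integral_congr_ae (Eventually.of_forall fun x => ?_)
      simp only [W]
      rcases le_total (u₁ x) (u₂ x) with h | h
      · rw [max_eq_right h, abs_of_nonpos (by linarith)]; ring
      · rw [max_eq_left h, abs_of_nonneg (by linarith)]; ring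
    rw [h3]
    simp only [S, H, Pi.add_apply, Pi.sub_apply]
    linarith
  have hcover : AECover (volume : Measure ℝ) atTop fun n : ℕ => Ioc (-(n : ℝ)) n :=
    aecover_Ioc (tendsto_neg_atTop_atBot.comp tendsto_natCast_atTop_atTop)
      tendsto_natCast_atTop_atTop
  refine le_of_tendsto' (hcover.lintegral_tendsto_of_nat
    ((measurable_deriv _).sub (measurable_deriv _)).enorm.aemeasurable) fun n => ?_
  have hn : -(n : ℝ) ≤ n := by linarith [n.cast_nonneg (α := ℝ)]
  have hac : AbsolutelyContinuousOnInterval S (-(n : ℝ)) n :=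
    (hS.lipschitzOnWith (s := _)).absolutelyContinuousOnInterval
  calc ∫⁻ x in Ioc (-(n : ℝ)) n, ‖deriv (H u₁) x - deriv (H u₂) x‖ₑ
      ≤ ∫⁻ x in Ioc (-(n : ℝ)) n, ENNReal.ofReal (deriv S x) :=
        lintegral_mono_ae (ae_restrict_of_ae hae)
    _ = ENNReal.ofReal (S n - S (-(n : ℝ))) := by
        rw [← hac.integral_deriv_eq_sub, intervalIntegral.integral_of_le hn,
          ofReal_integral_eq_lintegral_ofReal
            ((intervalIntegrable_iff_integrableOn_Ioc_of_le hn).1 hac.intervalIntegrable_deriv)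
            (Eventually.of_forall fun _ => hSm.deriv_nonneg)]
    _ ≤ ENNReal.ofReal (∫ x, ‖u₁ x - u₂ x‖) := ENNReal.ofReal_le_ofReal (hmass _ _)
    _ = ∫⁻ x, ‖u₁ x - u₂ x‖ₑ := ofReal_integral_norm_eq_lintegral_enorm (hu₁.sub hu₂)

lemma deriv_hopfLax_primitive_zero (hc : ConvexOn ℝ univ f) (hs : Superlinear f) {t : ℝ}
    (ht : 0 < t) : deriv (fun x => hopfLax f (primitive 0) x t) = 0 := by
  have hp := isPotential_primitive_of_integrable (integrable_zero ℝ ℝ volume)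
  have h0 : ∀ y, primitive 0 y = 0 := fun y => by simp [primitive]
  have hle : ∀ x y, hopfLax f (primitive 0) x t ≤ hopfLax f (primitive 0) y t := by
    intro x y
    obtain ⟨q, hq⟩ := exists_hopfLax_eq hp hc hs ht y
    have := hopfLax_le_sub_mul hp hc hs ht.le x q
    rw [h0] at this hq
    linarith
  have : (fun x => hopfLax f (primitive 0) x t) = fun _ => hopfLax f (primitive 0) 0 t :=
    funext fun x => le_antisymm (hle _ _) (hle _ _)
  rw [this]
  exact deriv_const' _

lemma integrable_deriv_hopfLax (hc : ConvexOn ℝ univ f) (hs : Superlinear f)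
    (hu : Integrable u₀) {t : ℝ} (ht : 0 < t) :
    Integrable (deriv fun x => hopfLax f (primitive u₀) x t) := by
  refine ⟨(measurable_deriv _).aestronglyMeasurable, ?_⟩
  have h := lintegral_enorm_deriv_hopfLax_sub_le hc hs hu (integrable_zero ℝ ℝ volume) ht
  rw [deriv_hopfLax_primitive_zero hc hs ht] at h
  simp only [Pi.zero_apply, sub_zero] at h
  exact h.trans_lt hu.2

/-! ### The Lax–Oleinik function on the half-plane and on strips -/

lemma measurableSet_univ_prod_Ioi (τ : ℝ) : MeasurableSet (univ ×ˢ Ioi τ : Set (ℝ × ℝ)) :=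
  MeasurableSet.univ.prod measurableSet_Ioi

lemma ae_halfPlane_of_forall_pos {P : ℝ × ℝ → Prop}
    (h : ∀ τ, 0 < τ → ∀ᵐ p : ℝ × ℝ, τ < p.2 → P p) : ∀ᵐ p ∂halfPlaneMeasure, P p := by
  rw [halfPlaneMeasure, ae_restrict_iff' (measurableSet_univ_prod_Ioi 0)]
  filter_upwards [ae_all_iff.2 fun n : ℕ => h (1 / (n + 1)) Nat.one_div_pos_of_nat] with p hp hp0
  obtain ⟨n, hn⟩ := exists_nat_one_div_lt (mem_Ioi.1 hp0.2)
  exact hp n hn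

lemma ae_halfPlane_of_ae_strip {P : ℝ × ℝ → Prop}
    (h : ∀ T, 0 < T → ∀ᵐ p ∂stripMeasure 0 T, P p) : ∀ᵐ p ∂halfPlaneMeasure, P p := by
  have h1 : ∀ n : ℕ, ∀ᵐ p : ℝ × ℝ, p ∈ univ ×ˢ Ioo (0 : ℝ) (n + 1) → P p := fun n => by
    have := h (n + 1) (by positivity)
    rwa [stripMeasure, ae_restrict_iff' (MeasurableSet.univ.prod measurableSet_Ioo)] at this
  rw [halfPlaneMeasure, ae_restrict_iff' (measurableSet_univ_prod_Ioi 0)]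
  filter_upwards [ae_all_iff.2 h1] with p hp hp0
  obtain ⟨n, hn⟩ := exists_nat_gt p.2
  exact hp n ⟨trivial, hp0.2, by linarith⟩

lemma stripMeasure_le_halfPlaneMeasure {τ : ℝ} (hτ : 0 ≤ τ) (T : ℝ) :
    stripMeasure τ T ≤ halfPlaneMeasure :=
  Measure.restrict_mono (prod_mono_right fun _ ht => hτ.trans_lt ht.1) le_rfl

lemma stripMeasure_eq_prod (τ T : ℝ) :
    stripMeasure τ T = (volume : Measure ℝ).prod (volume.restrict (Ioo τ T)) := by
  rw [stripMeasure, Measure.volume_eq_prod, ← Measure.prod_restrict, Measure.restrict_univ]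

/-- `u₀` is an admissible datum: its primitive is a potential and the Hopf–Lax function is
Lipschitz in `x`, uniformly in `t ≥ τ`, for every `τ > 0`. -/
structure IsDatum (f u₀ : ℝ → ℝ) : Prop where
  isPotential : IsPotential (primitive u₀)
  exists_lipschitzWith : ∀ τ, 0 < τ → ∃ K : ℝ≥0, ∀ t, τ ≤ t →
    LipschitzWith K fun x => hopfLax f (primitive u₀) x t

lemma isDatum_of_integrable (hc : ConvexOn ℝ univ f) (hs : Superlinear f) (hu : Integrable u₀) :
    IsDatum f u₀ :=
  ⟨isPotential_primitive_of_integrable hu, fun _ hτ =>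
    exists_lipschitzWith_hopfLax_primitive hc hs hu hτ⟩

lemma exists_lipschitzWith_hopfLax_of_memLp_top (hc : ConvexOn ℝ univ f) (hs : Superlinear f)
    (hu : MemLp u₀ ⊤ volume) :
    ∃ K : ℝ≥0, ∀ t, 0 ≤ t → LipschitzWith K fun x => hopfLax f (primitive u₀) x t := by
  obtain ⟨K, hK⟩ := exists_lipschitzWith_primitive hu
  exact ⟨K, fun t ht => lipschitzWith_hopfLax_of_lipschitzWith
    (isPotential_primitive_of_memLp_top hu) hc hs hK ht⟩

lemma isDatum_of_memLp_top (hc : ConvexOn ℝ univ f) (hs : Superlinear f)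
    (hu : MemLp u₀ ⊤ volume) : IsDatum f u₀ := by
  obtain ⟨K, hK⟩ := exists_lipschitzWith_hopfLax_of_memLp_top hc hs hu
  exact ⟨isPotential_primitive_of_memLp_top hu, fun _ hτ => ⟨K, fun t ht => hK t (hτ.le.trans ht)⟩⟩

lemma IsDatum.ae_differentiableAt (hd : IsDatum f u₀) (hc : ConvexOn ℝ univ f)
    (hs : Superlinear f) : ∀ᵐ p ∂halfPlaneMeasure,
      DifferentiableAt ℝ (fun p : ℝ × ℝ => hopfLax f (primitive u₀) p.1 p.2) p := by
  refine ae_halfPlane_of_forall_pos fun τ hτ => ?_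
  obtain ⟨K, hK⟩ := hd.exists_lipschitzWith τ hτ
  obtain ⟨C, hC⟩ := exists_lipschitzWith_hopfLax_max hd.isPotential hc hs hτ.le hK
  filter_upwards [hC.ae_differentiableAt (μ := volume)] with p hp hpτ
  refine hp.congr_of_eventuallyEq ?_
  filter_upwards [continuous_snd.continuousAt.eventually (lt_mem_nhds hpτ)] with q hq
  simp only [max_eq_left (le_of_lt hq)]

lemma IsDatum.aestronglyMeasurable (hd : IsDatum f u₀) (hc : ConvexOn ℝ univ f)
    (hs : Superlinear f) : AEStronglyMeasurable (laxOleinik f u₀) halfPlaneMeasure := by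
  refine ⟨fun p => fderiv ℝ (fun p : ℝ × ℝ => hopfLax f (primitive u₀) p.1 p.2) p (1, 0),
    (measurable_fderiv_apply_const ℝ _ _).stronglyMeasurable, ?_⟩
  filter_upwards [hd.ae_differentiableAt hc hs,
    ae_restrict_mem (measurableSet_univ_prod_Ioi 0)] with p hp hp0
  rw [laxOleinik_eq_deriv_hopfLax hp0.2]
  exact hp.hasDerivAt_fst.deriv

lemma abs_laxOleinik_le {K : ℝ≥0} {p : ℝ × ℝ} (hp : 0 < p.2)
    (hK : LipschitzWith K fun x => hopfLax f (primitive u₀) x p.2) : |laxOleinik f u₀ p| ≤ K := by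
  rw [laxOleinik_eq_deriv_hopfLax hp]
  exact norm_deriv_le_of_lipschitz hK

lemma isBoundedWeakSolution_laxOleinik (hc : ConvexOn ℝ univ f) (hs : Superlinear f)
    (hu : MemLp u₀ ⊤ volume) : IsBoundedWeakSolution f u₀ (laxOleinik f u₀) := by
  obtain ⟨K, hK⟩ := exists_lipschitzWith_hopfLax_of_memLp_top hc hs hu
  have hd := isDatum_of_memLp_top hc hs hu
  refine ⟨memLp_top_of_bound (hd.aestronglyMeasurable hc hs) K ?_, fun φ hφ hφc => ?_⟩
  · filter_upwards [ae_restrict_mem (measurableSet_univ_prod_Ioi 0)] with p hp0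
    exact abs_laxOleinik_le hp0.2 (hK _ (le_of_lt hp0.2))
  · refine Eq.trans ?_ (integral_hopfLax_weak hd.isPotential hc hs le_rfl hK hφ hφc)
    congr 1
    · refine setIntegral_congr_fun (measurableSet_univ_prod_Ioi 0) fun p hp => ?_
      simp only [laxOleinik_eq_deriv_hopfLax hp.2]
    · refine integral_congr_ae ?_
      filter_upwards [LocallyIntegrable.ae_hasDerivAt_integral
        (hu.locallyIntegrable le_top)] with x hx
      have h0 : (fun x => hopfLax f (primitive u₀) x 0) = primitive u₀ :=
        funext fun x => hopfLax_of_nonpos le_rfl x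
      have h1 : deriv (primitive u₀) x = u₀ x := (hx 0).deriv
      simp only [h0, h1]

lemma laxOleinik_mono (hc : ConvexOn ℝ univ f) (hs : Superlinear f) (hu₁ : MemLp u₁ ⊤ volume)
    (hu₂ : MemLp u₂ ⊤ volume) (h : ∀ᵐ x, u₁ x ≤ u₂ x) :
    ∀ᵐ p ∂halfPlaneMeasure, laxOleinik f u₁ p ≤ laxOleinik f u₂ p := by
  filter_upwards [(isDatum_of_memLp_top hc hs hu₁).ae_differentiableAt hc hs,
    (isDatum_of_memLp_top hc hs hu₂).ae_differentiableAt hc hs,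
    ae_restrict_mem (measurableSet_univ_prod_Ioi 0)] with p h1 h2 hp0
  have hm := monotone_hopfLax_sub (isPotential_primitive_of_memLp_top hu₁)
    (isPotential_primitive_of_memLp_top hu₂) hc hs (monotone_primitive_sub
      (hu₁.locallyIntegrable le_top) (hu₂.locallyIntegrable le_top) h) (le_of_lt hp0.2)
  have hd := (h2.hasDerivAt_fst.sub h1.hasDerivAt_fst).deriv
  have := hm.deriv_nonneg (x := p.1)
  rw [laxOleinik_eq_deriv_hopfLax hp0.2, laxOleinik_eq_deriv_hopfLax hp0.2,
    h1.hasDerivAt_fst.deriv, h2.hasDerivAt_fst.deriv, ← sub_nonneg, ← hd]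
  exact this

lemma eLpNorm_laxOleinik_sub_le (hc : ConvexOn ℝ univ f) (hs : Superlinear f)
    (hu₁ : Integrable u₁) (hu₂ : Integrable u₂) {τ : ℝ} (hτ : 0 ≤ τ) (T : ℝ) :
    eLpNorm (laxOleinik f u₁ - laxOleinik f u₂) 1 (stripMeasure τ T) ≤
      ENNReal.ofReal (T - τ) * eLpNorm (u₁ - u₂) 1 volume := by
  have hm : AEStronglyMeasurable (laxOleinik f u₁ - laxOleinik f u₂) (stripMeasure τ T) :=
    (((isDatum_of_integrable hc hs hu₁).aestronglyMeasurable hc hs).sub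
      ((isDatum_of_integrable hc hs hu₂).aestronglyMeasurable hc hs)).mono_measure
      (stripMeasure_le_halfPlaneMeasure hτ T)
  rw [eLpNorm_one_eq_lintegral_enorm, eLpNorm_one_eq_lintegral_enorm]
  rw [stripMeasure_eq_prod] at hm ⊢
  rw [lintegral_prod_symm _ hm.enorm]
  calc ∫⁻ t in Ioo τ T, ∫⁻ x, ‖(laxOleinik f u₁ - laxOleinik f u₂) (x, t)‖ₑ
      ≤ ∫⁻ _ in Ioo τ T, ∫⁻ x, ‖u₁ x - u₂ x‖ₑ := by
        refine setLIntegral_mono' measurableSet_Ioo fun t ht => ?_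
        have ht0 : 0 < t := hτ.trans_lt ht.1
        convert lintegral_enorm_deriv_hopfLax_sub_le hc hs hu₁ hu₂ ht0 using 5 with x
        exact congrArg₂ (· - ·) (laxOleinik_eq_deriv_hopfLax (p := (x, t)) ht0)
          (laxOleinik_eq_deriv_hopfLax (p := (x, t)) ht0)
    _ = ENNReal.ofReal (T - τ) * ∫⁻ x, ‖(u₁ - u₂) x‖ₑ := by
        rw [setLIntegral_const, Real.volume_Ioo, mul_comm]; rfl

lemma memLp_one_laxOleinik (hc : ConvexOn ℝ univ f) (hs : Superlinear f) (hu : Integrable u₀)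
    (T : ℝ) : MemLp (laxOleinik f u₀) 1 (stripMeasure 0 T) := by
  have h0 := integrable_zero ℝ ℝ volume
  have hd := (isDatum_of_integrable hc hs hu).aestronglyMeasurable hc hs
  refine ⟨hd.mono_measure (stripMeasure_le_halfPlaneMeasure le_rfl T), ?_⟩
  have h := eLpNorm_laxOleinik_sub_le hc hs hu h0 le_rfl T
  have hz : laxOleinik f u₀ =ᵐ[stripMeasure 0 T]
      laxOleinik f u₀ - laxOleinik f 0 := by
    filter_upwards [ae_restrict_mem (MeasurableSet.univ.prod measurableSet_Ioo)] with p hp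
    have h1 := congrFun (deriv_hopfLax_primitive_zero hc hs hp.2.1) p.1
    rw [Pi.sub_apply, laxOleinik_eq_deriv_hopfLax (u₀ := 0) hp.2.1]
    exact (sub_eq_self.2 h1).symm
  rw [eLpNorm_congr_ae hz]
  refine h.trans_lt (ENNReal.mul_lt_top ENNReal.ofReal_lt_top ?_)
  exact (memLp_one_iff_integrable.2 (hu.sub h0)).2

/-! ### Limits in `L¹` of strips -/

lemma IsLimitL1.ae_eq {μ : Measure (ℝ × ℝ)} {u : ℕ → ℝ × ℝ → ℝ} {v v' : ℝ × ℝ → ℝ}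
    (hu : ∀ n, AEStronglyMeasurable (u n) μ) (h : IsLimitL1 μ u v) (h' : IsLimitL1 μ u v') :
    v =ᵐ[μ] v' := by
  have hle : ∀ n, eLpNorm (v - v') 1 μ ≤ eLpNorm (u n - v) 1 μ + eLpNorm (u n - v') 1 μ := by
    intro n
    rw [show v - v' = (u n - v') - (u n - v) by abel, add_comm]
    exact eLpNorm_sub_le ((hu n).sub h'.memLp_one.1) ((hu n).sub h.memLp_one.1) le_rfl
  have h0 : eLpNorm (v - v') 1 μ ≤ 0 := by
    refine ge_of_tendsto' (x := atTop) ?_ hle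
    simpa using h.tendsto.add h'.tendsto
  rw [nonpos_iff_eq_zero, eLpNorm_eq_zero_iff (h.memLp_one.1.sub h'.memLp_one.1) one_ne_zero] at h0
  filter_upwards [h0] with p hp
  exact sub_eq_zero.1 hp

lemma IsLimitL1.isCauchyL1 {μ : Measure (ℝ × ℝ)} {u : ℕ → ℝ × ℝ → ℝ} {v : ℝ × ℝ → ℝ}
    (hu : ∀ n, MemLp (u n) 1 μ) (h : IsLimitL1 μ u v) : IsCauchyL1 μ u := by
  refine ⟨hu, fun ε hε => ?_⟩
  obtain ⟨M, hM⟩ := eventually_atTop.1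
    (h.tendsto.eventually_lt_const (ENNReal.half_pos hε.ne'))
  refine ⟨M, fun m hm n hn => ?_⟩
  calc eLpNorm (u m - u n) 1 μ = eLpNorm ((u m - v) - (u n - v)) 1 μ := by
        rw [sub_sub_sub_cancel_right]
    _ ≤ eLpNorm (u m - v) 1 μ + eLpNorm (u n - v) 1 μ :=
        eLpNorm_sub_le ((hu m).1.sub h.memLp_one.1) ((hu n).1.sub h.memLp_one.1) le_rfl
    _ < ε / 2 + ε / 2 := ENNReal.add_lt_add (hM m hm) (hM n hn)
    _ = ε := ENNReal.add_halves ε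

lemma IsApproximation.integrable {w : ℕ → ℝ → ℝ} (h : IsApproximation w u₀) (n : ℕ) :
    Integrable (w n) :=
  memLp_one_iff_integrable.1 (h.memLp_one n)

lemma IsApproximation.integrable_limit {w : ℕ → ℝ → ℝ} (h : IsApproximation w u₀) : Integrable u₀ :=
  memLp_one_iff_integrable.1 h.memLp_one_limit

/-- The limit of the approximating solutions is the Lax–Oleinik function of the limit datum, which
is defined because the primitive of an integrable function is bounded. -/
lemma IsApproximation.isLimitL1 {w : ℕ → ℝ → ℝ} (h : IsApproximation w u₀) (hc : ConvexOn ℝ univ f)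
    (hs : Superlinear f) (T : ℝ) :
    IsLimitL1 (stripMeasure 0 T) (fun n => laxOleinik f (w n)) (laxOleinik f u₀) := by
  refine ⟨memLp_one_laxOleinik hc hs h.integrable_limit T, ?_⟩
  refine tendsto_of_tendsto_of_tendsto_of_le_of_le tendsto_const_nhds ?_ (fun _ => zero_le)
    fun n => eLpNorm_laxOleinik_sub_le hc hs (h.integrable n) h.integrable_limit le_rfl T
  simpa using ENNReal.Tendsto.const_mul h.tendsto (Or.inr ENNReal.ofReal_ne_top)

lemma IsApproximation.ae_eq_laxOleinik {w : ℕ → ℝ → ℝ} (h : IsApproximation w u₀)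
    (hc : ConvexOn ℝ univ f) (hs : Superlinear f) {T : ℝ} {u : ℝ × ℝ → ℝ}
    (hu : IsLimitL1 (stripMeasure 0 T) (fun n => laxOleinik f (w n)) u) :
    u =ᵐ[stripMeasure 0 T] laxOleinik f u₀ :=
  hu.ae_eq (fun n => (memLp_one_laxOleinik hc hs (h.integrable n) T).1) (h.isLimitL1 hc hs T)

lemma IsApproximation.ae_eq_laxOleinik_halfPlane {w : ℕ → ℝ → ℝ} (h : IsApproximation w u₀)
    (hc : ConvexOn ℝ univ f) (hs : Superlinear f) {u : ℝ × ℝ → ℝ}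
    (hu : ∀ T : ℝ, 0 < T → IsLimitL1 (stripMeasure 0 T) (fun n => laxOleinik f (w n)) u) :
    u =ᵐ[halfPlaneMeasure] laxOleinik f u₀ :=
  ae_halfPlane_of_ae_strip fun T hT => h.ae_eq_laxOleinik hc hs (hu T hT)

lemma integral_abs_laxOleinik_sub_le (hc : ConvexOn ℝ univ f)
    (hs : Superlinear f) (hu₁ : Integrable u₁) (hu₂ : Integrable u₂) {τ T : ℝ} (hτ : 0 ≤ τ)
    (hT : τ ≤ T) :
    ∫ p, |laxOleinik f u₁ p - laxOleinik f u₂ p| ∂(stripMeasure τ T) ≤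
      (T - τ) * ∫ x : ℝ, |u₁ x - u₂ x| := by
  have hm : AEStronglyMeasurable (fun p => laxOleinik f u₁ p - laxOleinik f u₂ p)
      (stripMeasure τ T) :=
    (((isDatum_of_integrable hc hs hu₁).aestronglyMeasurable hc hs).sub
      ((isDatum_of_integrable hc hs hu₂).aestronglyMeasurable hc hs)).mono_measure
      (stripMeasure_le_halfPlaneMeasure hτ T)
  have h1 := integral_norm_eq_lintegral_enorm hm
  have h2 := integral_norm_eq_lintegral_enorm (hu₁.sub hu₂).1
  have h3 := eLpNorm_laxOleinik_sub_le hc hs hu₁ hu₂ hτ T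
  rw [eLpNorm_one_eq_lintegral_enorm, eLpNorm_one_eq_lintegral_enorm] at h3
  simp only [Real.norm_eq_abs, Pi.sub_apply] at h1 h2 h3
  rw [h1, h2, ← ENNReal.toReal_ofReal (sub_nonneg.2 hT), ← ENNReal.toReal_mul]
  exact ENNReal.toReal_mono (ENNReal.mul_ne_top ENNReal.ofReal_ne_top (hu₁.sub hu₂).2.ne) h3

/-! ### The solution with integrable datum -/

lemma exists_pos_lt_snd_of_isCompact {K : Set (ℝ × ℝ)} (hK : IsCompact K)
    (hKs : K ⊆ univ ×ˢ Ioi (0 : ℝ)) : ∃ τ : ℝ, 0 < τ ∧ ∀ p ∈ K, τ < p.2 := by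
  rcases K.eq_empty_or_nonempty with rfl | hne
  · exact ⟨1, one_pos, by simp⟩
  obtain ⟨p, hp, hmin⟩ := hK.exists_isMinOn hne continuous_snd.continuousOn
  have hp0 : 0 < p.2 := (hKs hp).2
  exact ⟨p.2 / 2, half_pos hp0, fun q hq => (half_lt_self hp0).trans_le (hmin hq)⟩

lemma exists_abs_laxOleinik_le_of_isCompact (hc : ConvexOn ℝ univ f) (hs : Superlinear f)
    (hu : Integrable u₀) {K : Set (ℝ × ℝ)} (hK : IsCompact K) (hKs : K ⊆ univ ×ˢ Ioi (0 : ℝ)) :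
    ∃ C, ∀ p ∈ K, |laxOleinik f u₀ p| ≤ C := by
  obtain ⟨τ, hτ, hKτ⟩ := exists_pos_lt_snd_of_isCompact hK hKs
  obtain ⟨C, hC⟩ := exists_lipschitzWith_hopfLax_primitive hc hs hu hτ
  exact ⟨C, fun p hp => abs_laxOleinik_le (hKs hp).2 (hC _ (hKτ p hp).le)⟩

/-- Continuous functions of the solution are bounded on compact subsets of the open half-plane. -/
lemma memLp_top_comp_laxOleinik (hc : ConvexOn ℝ univ f) (hs : Superlinear f)
    (hu : Integrable u₀) {g : ℝ → ℝ} (hg : Continuous g) {K : Set (ℝ × ℝ)} (hK : IsCompact K)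
    (hKs : K ⊆ univ ×ˢ Ioi (0 : ℝ)) :
    MemLp (fun p => g (laxOleinik f u₀ p)) ⊤ (volume.restrict K) := by
  obtain ⟨C, hC⟩ := exists_abs_laxOleinik_le_of_isCompact hc hs hu hK hKs
  obtain ⟨B, hB⟩ := (isCompact_Icc (a := -C) (b := C)).exists_bound_of_continuousOn hg.continuousOn
  have hm := ((isDatum_of_integrable hc hs hu).aestronglyMeasurable hc hs).mono_measure
    (Measure.restrict_mono hKs le_rfl)
  refine memLp_top_of_bound (hg.comp_aestronglyMeasurable hm) B ?_
  filter_upwards [ae_restrict_mem hK.measurableSet] with p hp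
  exact hB _ (abs_le.1 (hC p hp))

lemma isDistributionalSolution_laxOleinik (hc : ConvexOn ℝ univ f) (hs : Superlinear f)
    (hu : Integrable u₀) : IsDistributionalSolution f (laxOleinik f u₀) := by
  have hloc : ∀ {g : ℝ → ℝ}, Continuous g →
      LocallyIntegrableOn (fun p => g (laxOleinik f u₀ p)) (univ ×ˢ Ioi (0 : ℝ)) := by
    intro g hg
    rw [locallyIntegrableOn_iff (isOpen_univ.prod isOpen_Ioi).isLocallyClosed]
    intro K hKs hK
    have : IsFiniteMeasure (volume.restrict K : Measure (ℝ × ℝ)) :=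
      isFiniteMeasure_restrict.2 hK.measure_ne_top
    exact (memLp_top_comp_laxOleinik hc hs hu hg hK hKs).integrable le_top
  refine ⟨hloc continuous_id, hloc hc.locallyLipschitz.continuous, fun φ hφ hφc hφs => ?_⟩
  obtain ⟨τ, hτ, hφτ⟩ := exists_pos_lt_snd_of_isCompact hφc hφs
  obtain ⟨K, hK⟩ := exists_lipschitzWith_hopfLax_primitive hc hs hu hτ
  have h := integral_hopfLax_weak (isPotential_primitive_of_integrable hu) hc hs hτ.le hK hφ hφc
  have h0 : ∀ x, φ (x, τ) = 0 := fun x => by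
    by_contra hne
    exact lt_irrefl _ (hφτ _ (subset_tsupport _ hne))
  simp only [h0, mul_zero, integral_zero, add_zero] at h
  rw [← h, halfPlaneMeasure]
  symm
  trans ∫ p in univ ×ˢ Ioi τ, (laxOleinik f u₀ p * partialT φ p
    + f (laxOleinik f u₀ p) * partialX φ p)
  · refine setIntegral_congr_fun (measurableSet_univ_prod_Ioi τ) fun p hp => ?_
    simp only [laxOleinik_eq_deriv_hopfLax (hτ.trans hp.2)]
  · refine (setIntegral_eq_of_subset_of_forall_sdiff_eq_zero (measurableSet_univ_prod_Ioi 0)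
      (prod_mono_right (Ioi_subset_Ioi hτ.le)) fun p hp => ?_).symm
    have hp' : p ∉ tsupport φ := fun hmem => hp.2 ⟨trivial, hφτ p hmem⟩
    have hz : fderiv ℝ φ p = 0 := by
      by_contra hne
      exact hp' (support_fderiv_subset ℝ hne)
    simp [partialT, partialX, hz]

lemma IsDistributionalSolution.congr_ae {u v : ℝ × ℝ → ℝ} (h : IsDistributionalSolution f v)
    (huv : u =ᵐ[halfPlaneMeasure] v) : IsDistributionalSolution f u := by
  have hloc : ∀ {g h : ℝ × ℝ → ℝ}, g =ᵐ[halfPlaneMeasure] h →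
      LocallyIntegrableOn h (univ ×ˢ Ioi (0 : ℝ)) →
      LocallyIntegrableOn g (univ ×ˢ Ioi (0 : ℝ)) := by
    intro g h hgh hh
    rw [locallyIntegrableOn_iff (isOpen_univ.prod isOpen_Ioi).isLocallyClosed] at hh ⊢
    exact fun K hKs hK => (hh K hKs hK).congr
      (ae_mono (Measure.restrict_mono hKs le_rfl) hgh.symm)
  refine ⟨hloc huv h.locallyIntegrable, hloc (huv.mono fun p hp => by simp only [hp])
    h.locallyIntegrable_flux, fun φ h1 h2 h3 => ?_⟩
  rw [← h.weak φ h1 h2 h3]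
  refine integral_congr_ae ?_
  filter_upwards [huv] with p hp
  rw [hp]

/-- The datum is attained in the sense of integrals over intervals, because the integral of the
solution over `[a, b]` is `V(b, t) - V(a, t)`. -/
lemma tendsto_integral_laxOleinik (hc : ConvexOn ℝ univ f) (hs : Superlinear f)
    (hu : Integrable u₀) (a b : ℝ) :
    Tendsto (fun t => ∫ x in a..b, laxOleinik f u₀ (x, t)) (𝓝[>] 0) (𝓝 (∫ x in a..b, u₀ x)) := by
  have hp := isPotential_primitive_of_integrable hu
  rw [← primitive_sub_primitive hu.locallyIntegrable]
  refine ((tendsto_hopfLax hp hc hs (abs_primitive_le hu) b).sub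
    (tendsto_hopfLax hp hc hs (abs_primitive_le hu) a)).congr' ?_
  filter_upwards [self_mem_nhdsWithin] with t (ht : 0 < t)
  obtain ⟨K, hK⟩ := exists_lipschitzWith_hopfLax_primitive hc hs hu ht
  have hac : AbsolutelyContinuousOnInterval (fun x => hopfLax f (primitive u₀) x t) a b :=
    ((hK t le_rfl).lipschitzOnWith (s := _)).absolutelyContinuousOnInterval
  rw [← hac.integral_deriv_eq_sub]
  refine intervalIntegral.integral_congr fun x _ => ?_
  exact (laxOleinik_eq_deriv_hopfLax (p := (x, t)) ht).symm

lemma ae_slices_of_ae_halfPlane {P : ℝ × ℝ → Prop} (h : ∀ᵐ p ∂halfPlaneMeasure, P p) :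
    ∀ᵐ t ∂(volume.restrict (Ioi (0 : ℝ))), ∀ᵐ x : ℝ, P (x, t) := by
  rw [halfPlaneMeasure, Measure.volume_eq_prod, ← Measure.prod_restrict,
    Measure.restrict_univ] at h
  exact Measure.ae_ae_of_ae_prod (Measure.measurePreserving_swap.quasiMeasurePreserving.ae h)

end ScalarConservation

open ScalarConservation
theorem theorem2 (f : ℝ → ℝ) (hconv : ConvexOn ℝ univ f) (hsuper : Superlinear f) :
    -- the Lax-Oleinik function of a bounded datum is well defined a.e. and is a weak solution
    (∀ u₀ : ℝ → ℝ, MemLp u₀ ⊤ volume →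
      (∀ᵐ p ∂halfPlaneMeasure,
        DifferentiableAt ℝ (fun x : ℝ => valueFunction f u₀ x p.2) p.1) ∧
      IsBoundedWeakSolution f u₀ (laxOleinik f u₀)) ∧
    -- comparison principle
    (∀ u₁₀ u₂₀ : ℝ → ℝ, MemLp u₁₀ ⊤ volume → MemLp u₂₀ ⊤ volume →
      (∀ᵐ x : ℝ, u₁₀ x ≤ u₂₀ x) →
      ∀ᵐ p ∂halfPlaneMeasure, laxOleinik f u₁₀ p ≤ laxOleinik f u₂₀ p) ∧
    -- the approximating solutions are Cauchy and have a limit, the same for all T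
    (∀ (u₀ : ℝ → ℝ) (w : ℕ → ℝ → ℝ), IsApproximation w u₀ →
      (∀ T : ℝ, 0 < T → IsCauchyL1 (stripMeasure 0 T) (fun n => laxOleinik f (w n))) ∧
      ∃ u : ℝ × ℝ → ℝ, ∀ T : ℝ, 0 < T →
        IsLimitL1 (stripMeasure 0 T) (fun n => laxOleinik f (w n)) u) ∧
    -- contraction in L¹ for the limits
    (∀ (u₁₀ u₂₀ : ℝ → ℝ) (w₁ w₂ : ℕ → ℝ → ℝ),
      IsApproximation w₁ u₁₀ → IsApproximation w₂ u₂₀ →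
      ∀ (T : ℝ) (u₁ u₂ : ℝ × ℝ → ℝ),
        IsLimitL1 (stripMeasure 0 T) (fun n => laxOleinik f (w₁ n)) u₁ →
        IsLimitL1 (stripMeasure 0 T) (fun n => laxOleinik f (w₂ n)) u₂ →
        ∀ τ : ℝ, 0 < τ → τ < T →
          ∫ p, |u₁ p - u₂ p| ∂(stripMeasure τ T) ≤ (T - τ) * ∫ x : ℝ, |u₁₀ x - u₂₀ x|) ∧
    -- the limit does not depend on the approximation
    (∀ (u₀ : ℝ → ℝ) (w z : ℕ → ℝ → ℝ), IsApproximation w u₀ → IsApproximation z u₀ →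
      ∀ u v : ℝ × ℝ → ℝ,
        (∀ T : ℝ, 0 < T → IsLimitL1 (stripMeasure 0 T) (fun n => laxOleinik f (w n)) u) →
        (∀ T : ℝ, 0 < T → IsLimitL1 (stripMeasure 0 T) (fun n => laxOleinik f (z n)) v) →
        u =ᵐ[halfPlaneMeasure] v) ∧
    -- the limit is locally bounded, is a distributional solution and attains the initial datum
    (∀ (u₀ : ℝ → ℝ) (w : ℕ → ℝ → ℝ), IsApproximation w u₀ →
      ∀ u : ℝ × ℝ → ℝ,
        (∀ T : ℝ, 0 < T → IsLimitL1 (stripMeasure 0 T) (fun n => laxOleinik f (w n)) u) →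
        (∀ K : Set (ℝ × ℝ), IsCompact K → K ⊆ univ ×ˢ Ioi (0 : ℝ) →
          MemLp u ⊤ (volume.restrict K)) ∧
        IsDistributionalSolution f u ∧
        ∃ N : Set ℝ, volume N = 0 ∧
          (∀ t : ℝ, 0 < t → t ∉ N → Integrable (fun x : ℝ => u (x, t))) ∧
          ∀ a b : ℝ, a ≤ b →
            Tendsto (fun t : ℝ => ∫ x in a..b, u (x, t)) (𝓝[Ioi 0 \ N] 0)
              (𝓝 (∫ x in a..b, u₀ x))) := by
  refine ⟨fun u₀ hu => ⟨?_, isBoundedWeakSolution_laxOleinik hconv hsuper hu⟩,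
    fun u₁ u₂ h₁ h₂ h => laxOleinik_mono hconv hsuper h₁ h₂ h,
    fun u₀ w h => ⟨fun T _ => ?_, laxOleinik f u₀, fun T _ => h.isLimitL1 hconv hsuper T⟩,
    fun u₁₀ u₂₀ w₁ w₂ h₁ h₂ T u₁ u₂ hu₁ hu₂ τ hτ hτT => ?_,
    fun u₀ w z hw hz u v hu hv => ?_, fun u₀ w h u hu => ?_⟩
  · filter_upwards [(isDatum_of_memLp_top hconv hsuper hu).ae_differentiableAt hconv hsuper,
      ae_restrict_mem (measurableSet_univ_prod_Ioi 0)] with p hp hp0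
    have hd := hp.hasDerivAt_fst.differentiableAt
    simpa only [hopfLax_primitive (show 0 < p.2 from hp0.2)] using hd
  · exact (h.isLimitL1 hconv hsuper T).isCauchyL1 fun n =>
      memLp_one_laxOleinik hconv hsuper (h.integrable n) T
  · have hle : stripMeasure τ T ≤ stripMeasure 0 T :=
      Measure.restrict_mono (prod_mono_right (Ioo_subset_Ioo_left hτ.le)) le_rfl
    refine le_of_eq_of_le (integral_congr_ae ?_) (integral_abs_laxOleinik_sub_le hconv hsuper
      h₁.integrable_limit h₂.integrable_limit hτ.le hτT.le)
    filter_upwards [ae_mono hle (h₁.ae_eq_laxOleinik hconv hsuper hu₁),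
      ae_mono hle (h₂.ae_eq_laxOleinik hconv hsuper hu₂)] with p hp₁ hp₂
    rw [hp₁, hp₂]
  · exact (hw.ae_eq_laxOleinik_halfPlane hconv hsuper hu).trans
      (hz.ae_eq_laxOleinik_halfPlane hconv hsuper hv).symm
  -- in the last part the limit is replaced by `laxOleinik f u₀`; `N` holds the times at which the
  -- two do not agree almost everywhere in `x`
  have hi := h.integrable_limit
  have hae := h.ae_eq_laxOleinik_halfPlane hconv hsuper hu
  refine ⟨fun K hK hKs => ?_,
    (isDistributionalSolution_laxOleinik hconv hsuper hi).congr_ae hae,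
    {t | 0 < t ∧ ¬ ∀ᵐ x : ℝ, u (x, t) = laxOleinik f u₀ (x, t)}, ?_, fun t ht htN => ?_,
    fun a b _ => ?_⟩
  · exact (memLp_top_comp_laxOleinik hconv hsuper hi continuous_id hK hKs).ae_eq
      (ae_mono (Measure.restrict_mono hKs le_rfl) hae.symm)
  · have hslice := ae_slices_of_ae_halfPlane hae
    rw [ae_restrict_iff' measurableSet_Ioi, ae_iff] at hslice
    simpa only [Classical.not_imp, mem_Ioi] using hslice
  · have hut : ∀ᵐ x : ℝ, u (x, t) = laxOleinik f u₀ (x, t) := by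
      by_contra hne
      exact htN ⟨ht, hne⟩
    refine (integrable_deriv_hopfLax hconv hsuper hi ht).congr ?_
    filter_upwards [hut] with x hx
    rw [hx]
    exact (laxOleinik_eq_deriv_hopfLax (p := (x, t)) ht).symm
  · refine ((tendsto_integral_laxOleinik hconv hsuper hi a b).mono_left
      (nhdsWithin_mono _ sdiff_subset)).congr' ?_
    filter_upwards [self_mem_nhdsWithin] with t ht
    have hut : ∀ᵐ x : ℝ, u (x, t) = laxOleinik f u₀ (x, t) := by
      by_contra hne
      exact ht.2 ⟨ht.1, hne⟩
    refine intervalIntegral.integral_congr_ae ?_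
    filter_upwards [hut] with x hx _
    exact hx.symm
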